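/- **Setting.** A target system $\mathcal S$ with Hilbert space $\mathscr H_{\mathcal S}$ (of finite or infinite dimension) starts in a density operator $\varrho_{\mathcal S}$, for instance a thermal state. A machine $\mathcal M$ has a Hamiltonian $H_{\mathcal M}=\sum_n\omega_n|n\rangle\langle n|$, where $(|n\rangle)_n$ is an orthonormal basis of its nonzero (finite- or infinite-dimensional) Hilbert space $\mathscr H_{\mathcal M}$ and $\mathcal Z=\sum_n e^{-\beta\omega_n}<\infty$ with $0<\beta<\infty$. It starts in the Gibbs state $\tau_{\mathcal M}=e^{-\beta H_{\mathcal M}}/\mathcal Z$. A unitary $U$ on $\mathscr H_{\mathcal S}\otimes\mathscr H_{\mathcal M}$ gives the final state $\varrho'_{\mathcal{SM}}=U(\varrho_{\mathcal S}\otimes\tau_{\mathcal M})U^\dagger$ with marginals $\varrho'_{\mathcal S},\varrho'_{\mathcal M}$. Let $S(\varrho)=-\operatorname{tr}(\varrho\log\varrho)$, $$\widetilde\Delta S_{\mathcal S}=S(\varrho_{\mathcal S})-S(\varrho_{\mathcal S}'),\qquad \Delta E_{\mathcal M}=\operatorname{tr}\{H_{\mathcal M}(\varrho'_{\mathcal M}-\tau_{\mathcal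 M})\}.$$ The Landauer bound is $\beta\Delta E_{\mathcal M}\ge\widetilde\Delta S_{\mathcal S}$. We say that $U$ *acts only on* a subspace $\mathcal A$ of the joint space if $U=U_{\mathcal A}\oplus\mathbb 1_{\mathcal A^\perp}$. The *effective dimension* $d^{\rm eff}(U)\in\mathbb N\cup\{\infty\}$ is the least dimension of such an $\mathcal A$. The *machine dimension* $d_{\mathcal M}(U)\in\mathbb N\cup\{\infty\}$ is the least dimension of a subspace $\mathcal V\subseteq\mathscr H_{\mathcal M}$ such that $U$ acts only on $\mathscr H_{\mathcal S}\otimes\mathcal V$. For a set $F$ of machine levels, $U$ *acts only on the levels in $F$* if it acts only on $\mathscr H_{\mathcal S}\otimes\operatorname{span}\{|n\rangle:n\in F\}$. **Theorem.** 1. (*Replacement.*) If $U$ acts only on the levels in a finite set $F$, there are a machine of finite dimension $N\le|F|+1$ with Hamiltonian $\widetilde H$, an assignment of the levels in $F$ to distinct levels of the new machine with the same energies, and a unitary $\widetilde U$ on $\mathscr H_{\mathcal S}\otimes\mathbb C^N$ that acts only on these levels and has there the same matrix elements as $U$, such that the partition function at $\beta$ is the same, and, with $\widetilde{U}$ applied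 to $\varrho_{\mathcal S}\otimes\tau(\beta,\widetilde H)$, the final target state $\varrho'_{\mathcal S}$, the entropy decrease $\widetilde\Delta S_{\mathcal S}$ and the machine energy change $\Delta E_{\mathcal M}$ are the same as for the original machine and $U$. 2. (*Finite-dimensional correction.*) For all $\delta>0$ and $m\in\mathbb N$ there is $c=c(\delta,m)>0$ such that, for every target, initial state with $S(\varrho_{\mathcal S})<\infty$, $\beta$, machine, and unitary $U$ acting only on at most $m$ machine levels, $$\widetilde\Delta S_{\mathcal S}\ge\delta\quad\Longrightarrow\quad\beta\,\Delta E_{\mathcal M}\ \ge\ \widetilde\Delta S_{\mathcal S}+c .$$ So such protocols cannot saturate the Landauer bound, not even asymptotically. 3. (*Divergence.*) Fix $\beta$, the target and $\varrho_{\mathcal S}$ with $S(\varrho_{\mathcal S})<\infty$. Let $(\mathcal M_k,U_k)_{k\in\mathbb N}$ be machines and unitaries, with finite initial and final mean energies of the machines, that cool the target, i.e. for some $\delta>0$ one has $\widetilde\Delta S_{\mathcal S}^{(k)}\ge\delta$ for all large $k$, and that saturate the Landauer limit, i.e. $\beta\Delta E^{(k)}_{\mathcal M}-\widetilde\Delta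 S^{(k)}_{\mathcal S}\to0$. Then $d_{\mathcal M}(U_k)\to\infty$ and $d^{\rm eff}(U_k)\to\infty$. In particular (constant sequences), a single unitary that attained the bound with equality while lowering the entropy of the target would have to act nontrivially on an infinite-dimensional subspace of the machine, with $d^{\rm eff}=\infty$. -/

import Mathlib

open Filter Topology
open scoped ENNReal InnerProductSpace

universe u v

noncomputable section

namespace LandauerCooling

/-- The Hilbert space `ℓ²(κ)`: a Hilbert space with a distinguished orthonormal basis indexed by
`κ` (for a machine, the energy eigenbasis). -/
abbrev Hilb (κ : Type u) : Type u := lp (fun _ : κ => ℂ) 2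

/-- The basis vector `|a⟩`. -/
def ket {κ : Type u} (a : κ) : Hilb κ :=
  letI := Classical.decEq κ
  lp.single 2 a (1 : ℂ)

theorem hasSum_tmul {κ : Type u} {ι : Type v} (x : Hilb κ) (v : Hilb ι) :
    HasSum (fun z : κ × ι => ‖(x : κ → ℂ) z.1 * (v : ι → ℂ) z.2‖ ^ (2 : ℝ))
      (‖x‖ ^ (2 : ℝ) * ‖v‖ ^ (2 : ℝ)) := by
  have hx := lp.hasSum_norm (p := 2) (by norm_num) x
  have hv := lp.hasSum_norm (p := 2) (by norm_num) v
  simp only [ENNReal.toReal_ofNat] at hx hv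
  have hs := hx.summable.mul_of_nonneg hv.summable (fun _ => by positivity) (fun _ => by positivity)
  have h := hx.mul hv hs
  refine h.congr_fun ?_ |> fun h' => h'
  intro z
  rw [norm_mul, Real.mul_rpow (norm_nonneg _) (norm_nonneg _)]

/-- The product vector `x ⊗ v` in `ℓ²(κ × ι) = ℓ²(κ) ⊗ ℓ²(ι)`. -/
def tmul {κ : Type u} {ι : Type v} (x : Hilb κ) (v : Hilb ι) : Hilb (κ × ι) :=
  ⟨fun z => (x : κ → ℂ) z.1 * (v : ι → ℂ) z.2, by
    apply memℓp_gen
    simpa using (hasSum_tmul x v).summable⟩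

theorem norm_tmul {κ : Type u} {ι : Type v} (x : Hilb κ) (v : Hilb ι) :
    ‖tmul x v‖ = ‖x‖ * ‖v‖ := by
  have h := lp.hasSum_norm (p := 2) (by norm_num) (tmul x v)
  have h2 := h.unique (by simpa [tmul] using hasSum_tmul x v)
  simp only [ENNReal.toReal_ofNat, Real.rpow_two] at h2
  rw [← mul_pow] at h2
  exact (pow_left_inj₀ (norm_nonneg _) (by positivity) two_ne_zero).1 h2

/-- The bounded operator `x ↦ x ⊗ v` from the target to the joint space. -/
def tensorRight {κ : Type u} {ι : Type v} (v : Hilb ι) : Hilb κ →L[ℂ] Hilb (κ × ι) :=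
  LinearMap.mkContinuous
    { toFun := fun x => tmul x v
      map_add' := fun x y => by ext z; exact add_mul _ _ _
      map_smul' := fun c x => by ext z; simp [tmul, mul_assoc] }
    ‖v‖ (fun x => by simp [norm_tmul, mul_comm])

/-- The bounded operator `v ↦ x ⊗ v` from the machine to the joint space. -/
def tensorLeft {κ : Type u} {ι : Type v} (x : Hilb κ) : Hilb ι →L[ℂ] Hilb (κ × ι) :=
  LinearMap.mkContinuous
    { toFun := fun v => tmul x v
      map_add' := fun x y => by ext z; exact mul_add _ _ _
      map_smul' := fun c x => by ext z; simp [tmul, mul_left_comm] }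
    ‖x‖ (fun v => by simp [norm_tmul])

/-- The partial trace over the machine, `∑ₙ (1 ⊗ ⟨n|) T (1 ⊗ |n⟩)`. The series converges in operator
norm for every density operator `T`. -/
def traceMachine {κ : Type u} {ι : Type v} (T : Hilb (κ × ι) →L[ℂ] Hilb (κ × ι)) :
    Hilb κ →L[ℂ] Hilb κ :=
  ∑' n : ι, ContinuousLinearMap.adjoint (tensorRight (ket n)) ∘L T ∘L tensorRight (ket n)

/-- The partial trace over the target, `∑ₐ (⟨a| ⊗ 1) T (|a⟩ ⊗ 1)`. -/
def traceTarget {κ : Type u} {ι : Type v} (T : Hilb (κ × ι) →L[ℂ] Hilb (κ × ι)) :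
    Hilb ι →L[ℂ] Hilb ι :=
  ∑' a : κ, ContinuousLinearMap.adjoint (tensorLeft (ket a)) ∘L T ∘L tensorLeft (ket a)

/-- `ρ` is a quantum state: a positive operator with trace one. -/
def IsState {κ : Type u} (ρ : Hilb κ →L[ℂ] Hilb κ) : Prop :=
  ρ.IsPositive ∧ HasSum (fun a => ⟪ket a, ρ (ket a)⟫_ℂ) 1

/-- The operator `η(ρ)` for `η(x) = -x log x`, given by the continuous functional calculus. -/
def negMulLogOp {H : Type u} [NormedAddCommGroup H] [InnerProductSpace ℂ H] [CompleteSpace H]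
    (ρ : H →L[ℂ] H) : H →L[ℂ] H :=
  cfc Real.negMulLog ρ

/-- The von Neumann entropy `S(ρ) = tr η(ρ)`, where `η(x) = -x log x`, as an element of `[0, ∞]`. -/
def entropy {κ : Type u} (ρ : Hilb κ →L[ℂ] Hilb κ) : ℝ≥0∞ :=
  ∑' a, ENNReal.ofReal (⟪ket a, negMulLogOp ρ (ket a)⟫_ℂ).re

/-- The partition function `Z(β, H) = ∑ₙ exp(-β ωₙ)` of the Hamiltonian `H = ∑ₙ ωₙ |n⟩⟨n|`. -/
def partitionFn {ι : Type v} (β : ℝ) (ω : ι → ℝ) : ℝ := ∑' n, Real.exp (-β * ω n)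

/-- The Gibbs population `exp(-β ωₙ) / Z(β, H)`. -/
def gibbsWeight {ι : Type v} (β : ℝ) (ω : ι → ℝ) (n : ι) : ℝ :=
  Real.exp (-β * ω n) / partitionFn β ω

/-- The Gibbs state `τ(β, H) = exp(-β H) / Z(β, H)` of the Hamiltonian `H = ∑ₙ ωₙ |n⟩⟨n|`. -/
def gibbsState {ι : Type v} (β : ℝ) (ω : ι → ℝ) : Hilb ι →L[ℂ] Hilb ι :=
  ∑' n, (gibbsWeight β ω n : ℂ) • InnerProductSpace.rankOne ℂ (ket n) (ket n)

/-- The initial joint state `ρ ⊗ τ(β, H) = ∑ₙ exp(-β ωₙ) / Z(β, H) · ρ ⊗ |n⟩⟨n|`. -/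
def initialState {κ : Type u} {ι : Type v} (β : ℝ) (ω : ι → ℝ) (ρ : Hilb κ →L[ℂ] Hilb κ) :
    Hilb (κ × ι) →L[ℂ] Hilb (κ × ι) :=
  ∑' n, (gibbsWeight β ω n : ℂ) •
    (tensorRight (ket n) ∘L ρ ∘L ContinuousLinearMap.adjoint (tensorRight (ket n)))

/-- The final joint state `U (ρ ⊗ τ(β, H)) U†`. -/
def finalState {κ : Type u} {ι : Type v} (β : ℝ) (ω : ι → ℝ) (ρ : Hilb κ →L[ℂ] Hilb κ)
    (U : unitary (Hilb (κ × ι) →L[ℂ] Hilb (κ × ι))) : Hilb (κ × ι) →L[ℂ] Hilb (κ × ι) :=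
  (U : Hilb (κ × ι) →L[ℂ] Hilb (κ × ι)) ∘L initialState β ω ρ ∘L
    ContinuousLinearMap.adjoint (U : Hilb (κ × ι) →L[ℂ] Hilb (κ × ι))

/-- The final state of the target. -/
def finalTarget {κ : Type u} {ι : Type v} (β : ℝ) (ω : ι → ℝ) (ρ : Hilb κ →L[ℂ] Hilb κ)
    (U : unitary (Hilb (κ × ι) →L[ℂ] Hilb (κ × ι))) : Hilb κ →L[ℂ] Hilb κ :=
  traceMachine (finalState β ω ρ U)

/-- The final state of the machine. -/
def finalMachine {κ : Type u} {ι : Type v} (β : ℝ) (ω : ι → ℝ) (ρ : Hilb κ →L[ℂ] Hilb κ)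
    (U : unitary (Hilb (κ × ι) →L[ℂ] Hilb (κ × ι))) : Hilb ι →L[ℂ] Hilb ι :=
  traceTarget (finalState β ω ρ U)

/-- The state `σ` has finite mean energy for the Hamiltonian `∑ₙ ωₙ |n⟩⟨n|`. -/
def HasFiniteEnergy {ι : Type v} (ω : ι → ℝ) (σ : Hilb ι →L[ℂ] Hilb ι) : Prop :=
  Summable fun n => ω n * (⟪ket n, σ (ket n)⟫_ℂ).re

/-- The energy change of the machine, `tr (H (ρ' - τ(β, H)))`, evaluated in the eigenbasis of `H`. -/
def energyChange {κ : Type u} {ι : Type v} (β : ℝ) (ω : ι → ℝ) (ρ : Hilb κ →L[ℂ] Hilb κ)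
    (U : unitary (Hilb (κ × ι) →L[ℂ] Hilb (κ × ι))) : ℝ :=
  ∑' n, ω n * (⟪ket n, (finalMachine β ω ρ U - gibbsState β ω) (ket n)⟫_ℂ).re

/-- The entropy decrease of the target, `S(ρ) - S(ρ')`; only used when both are finite. -/
def entropyDecrease {κ : Type u} {ι : Type v} (β : ℝ) (ω : ι → ℝ) (ρ : Hilb κ →L[ℂ] Hilb κ)
    (U : unitary (Hilb (κ × ι) →L[ℂ] Hilb (κ × ι))) : ℝ :=
  (entropy ρ).toReal - (entropy (finalTarget β ω ρ U)).toReal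

/-- `U = U_A ⊕ 1` with respect to the decomposition into `A` and its orthogonal complement. -/
def ActsOnlyOn {κ : Type u} (U : unitary (Hilb κ →L[ℂ] Hilb κ)) (A : Submodule ℂ (Hilb κ)) : Prop :=
  (∀ x ∈ A, (U : Hilb κ →L[ℂ] Hilb κ) x ∈ A) ∧ ∀ x ∈ Aᗮ, (U : Hilb κ →L[ℂ] Hilb κ) x = x

/-- The closed subspace `ℓ²(κ) ⊗ V` of the joint space, for a subspace `V` of the machine. -/
def targetTensor (κ : Type u) {ι : Type v} (V : Submodule ℂ (Hilb ι)) :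
    Submodule ℂ (Hilb (κ × ι)) :=
  (Submodule.span ℂ {z | ∃ x : Hilb κ, ∃ v ∈ V, z = tmul x v}).topologicalClosure

/-- The span of the energy eigenvectors `|n⟩`, `n ∈ F`. -/
def levelSpan {ι : Type v} (F : Set ι) : Submodule ℂ (Hilb ι) := Submodule.span ℂ (ket '' F)

/-- The effective dimension of `U`: the least dimension of a subspace `A` of the joint space with
`U = U_A ⊕ 1`. -/
def effectiveDim {κ : Type u} (U : unitary (Hilb κ →L[ℂ] Hilb κ)) : ℕ∞ :=
  ⨅ (A : Submodule ℂ (Hilb κ)) (_ : ActsOnlyOn U A), Cardinal.toENat (Module.rank ℂ A)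

/-- The least dimension of a subspace `V` of the machine such that `U` acts nontrivially only on
the tensor product of the target with `V`. -/
def machineDim {κ : Type u} {ι : Type v} (U : unitary (Hilb (κ × ι) →L[ℂ] Hilb (κ × ι))) : ℕ∞ :=
  ⨅ (V : Submodule ℂ (Hilb ι)) (_ : ActsOnlyOn U (targetTensor κ V)),
    Cardinal.toENat (Module.rank ℂ V)

end LandauerCooling

end

open LandauerCooling

-- Everything rests on a sharpened Klein inequality. Write the final joint state in its eigenbasis
-- U(eᵢ ⊗ |n⟩), with eigenvalues r = sᵢpₙ, where s is the spectrum of ϱ and p are the Gibbs weights.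
-- Compare it with a product basis e'ⱼ ⊗ |l⟩ of weights w = s'ⱼvₗ, where e' diagonalises the final
-- target state. The squared overlaps D form a doubly stochastic matrix. The pointwise bound r
-- log(r/w) ≥ r − w + (√r − √w)² (`negMulLog_add_sq_le`), summed against D, gives `entropy_balance`.
-- With v the final populations q it yields ΔS ≤ H(q) − H(p). With v = p it shows that the excess
-- βΔE − ΔS dominates a Hellinger-type distance between the final joint state and ϱ'_S ⊗ τ.
--
-- Replacement: levels outside F only ever contribute pₙϱ. Hence the final target state and the
-- energy change depend only on the blocks ⟨n|U|m⟩, n, m ∈ F, and the Gibbs weights on F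
-- (`finalTarget_eq`, `energyChange_eq_sum`). All other levels can be merged into one level carrying
-- the remaining partition sum.
--
-- Finite-size correction: on the replaced machine βΔE = H(q) − H(p) + D(q‖p), and D(q‖p) is at
-- least the squared Hellinger distance. If H(q) − H(p) ≥ ΔS ≥ δ, that distance is bounded below by
-- compactness of the simplex (`exists_hellinger_lower_bound`), with a constant that depends only on
-- δ and the number of levels.
--
-- Divergence: bounded machine or effective dimension bounds the total squared displacement ∑ₙ‖U(y ⊗
-- |n⟩) − y ⊗ |n⟩‖² uniformly in unit vectors y. Suppose the excess is tiny. Either the final target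
-- state is close to ϱ, or some eᵢ is visibly changed in the comparison. In the second case the
-- levels that U hardly moves must have little Gibbs weight, so τ is concentrated on boundedly many
-- levels (`exists_concentration`). In both cases entropy, tensored with an ancilla of boundedly
-- many levels, is lower semicontinuous (`exists_entropy_lt_add`), which gives S(ϱ) < S(ϱ'_S) + δ
-- and contradicts cooling.

universe w

namespace LandauerCooling

/-! ### Product vectors, overlaps and product bases -/

section Basics

variable {κ : Type u} {ι : Type v}

theorem inner_ket_left (a : κ) (x : Hilb κ) : ⟪ket a, x⟫_ℂ = x a := by
  classical
  have h := lp.inner_single_left (𝕜 := ℂ) (G := fun _ : κ => ℂ) a (1 : ℂ) x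
  unfold ket
  convert h using 1
  simp

/-- The standard basis as a Hilbert basis. -/
noncomputable def ketBasis (κ : Type u) : HilbertBasis κ ℂ (Hilb κ) :=
  HilbertBasis.ofRepr (LinearIsometryEquiv.refl ℂ (Hilb κ))

theorem ketBasis_apply (a : κ) : ketBasis κ a = ket a := by
  classical
  have h := (ketBasis κ).repr_symm_single a
  rw [← h]
  unfold ket
  change _ = (lp.single (E := fun _ : κ => ℂ) 2 a (1 : ℂ) : Hilb κ)
  congr!

theorem norm_ket (a : κ) : ‖ket a‖ = 1 := by
  rw [← ketBasis_apply]; exact (ketBasis κ).orthonormal.1 a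

theorem ket_apply (a b : κ) [Decidable (b = a)] : (ket a : κ → ℂ) b = if b = a then 1 else 0 := by
  classical
  rw [← inner_ket_left, ← ketBasis_apply, ← ketBasis_apply,
    orthonormal_iff_ite.1 (ketBasis κ).orthonormal]
  congr

theorem tmul_apply (x : Hilb κ) (v : Hilb ι) (z : κ × ι) :
    (tmul x v : κ × ι → ℂ) z = x z.1 * v z.2 := rfl

theorem tensorRight_apply (v : Hilb ι) (x : Hilb κ) : tensorRight v x = tmul x v := rfl

theorem tensorLeft_apply (x : Hilb κ) (v : Hilb ι) : tensorLeft x v = tmul x v := rfl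

theorem tmul_ket_ket (a : κ) (n : ι) : tmul (ket a) (ket n) = ket (a, n) := by
  classical
  ext ⟨b, m⟩
  rw [tmul_apply, ket_apply, ket_apply, ket_apply]
  by_cases h : b = a <;> by_cases h' : m = n <;> simp [h, h']

theorem hasSum_mul_prod {f : κ → ℂ} {g : ι → ℂ} {a b : ℂ} (hf : HasSum f a) (hg : HasSum g b) :
    HasSum (fun z : κ × ι => f z.1 * g z.2) (a * b) :=
  hf.mul hg (summable_mul_of_summable_norm hf.summable.norm hg.summable.norm)

theorem hasSum_inner_coord (x y : Hilb κ) : HasSum (fun a => y a * star (x a)) ⟪x, y⟫_ℂ :=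
  lp.hasSum_inner (𝕜 := ℂ) (G := fun _ : κ => ℂ) x y

theorem inner_tmul (x y : Hilb κ) (v w : Hilb ι) :
    ⟪tmul x v, tmul y w⟫_ℂ = ⟪x, y⟫_ℂ * ⟪v, w⟫_ℂ := by
  have h : HasSum (fun z : κ × ι => (y z.1 * w z.2) * star (x z.1 * v z.2))
      ⟪tmul x v, tmul y w⟫_ℂ := hasSum_inner_coord (tmul x v) (tmul y w)
  refine h.unique
    (HasSum.congr_fun (hasSum_mul_prod (hasSum_inner_coord x y) (hasSum_inner_coord v w)) ?_)
  intro z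
  rw [star_mul']
  ring

theorem tmul_sub_right (x : Hilb κ) (v w : Hilb ι) : tmul x (v - w) = tmul x v - tmul x w :=
  map_sub (tensorLeft x) v w

theorem inner_adjoint_tensorRight (n : ι) (x : Hilb κ) (z : Hilb (κ × ι)) :
    ⟪x, ContinuousLinearMap.adjoint (tensorRight (ket n)) z⟫_ℂ = ⟪tmul x (ket n), z⟫_ℂ := by
  rw [ContinuousLinearMap.adjoint_inner_right, tensorRight_apply]

theorem adjoint_tensorRight_ket_apply (n : ι) (z : Hilb (κ × ι)) (a : κ) :
    (ContinuousLinearMap.adjoint (tensorRight (ket n)) z : Hilb κ) a = z (a, n) := by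
  rw [← inner_ket_left, inner_adjoint_tensorRight, tmul_ket_ket, inner_ket_left]

theorem adjoint_tensorRight_tmul (v w : Hilb ι) (x : Hilb κ) :
    ContinuousLinearMap.adjoint (tensorRight v) (tmul x w) = ⟪v, w⟫_ℂ • x := by
  refine ext_inner_left ℂ fun y => ?_
  rw [ContinuousLinearMap.adjoint_inner_right, tensorRight_apply, inner_tmul, inner_smul_right,
    mul_comm]

theorem inner_ket_ket (n m : ι) [Decidable (n = m)] :
    ⟪ket n, ket m⟫_ℂ = if n = m then 1 else 0 := by
  rw [inner_ket_left, ket_apply]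

theorem norm_tensorRight_le (v : Hilb ι) : ‖(tensorRight v : Hilb κ →L[ℂ] _)‖ ≤ ‖v‖ :=
  LinearMap.mkContinuous_norm_le _ (norm_nonneg _) _

/-- The squared modulus of an inner product. -/
noncomputable def overlap {H : Type*} [NormedAddCommGroup H] [InnerProductSpace ℂ H] (x y : H) :
    ℝ≥0∞ := ENNReal.ofReal (‖⟪x, y⟫_ℂ‖ ^ 2)

section
variable {H : Type*} [NormedAddCommGroup H] [InnerProductSpace ℂ H] {K : Type*}

theorem overlap_comm (x y : H) : overlap x y = overlap y x := by
  rw [overlap, overlap, norm_inner_symm]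

theorem hasSum_norm_inner_sq (b : HilbertBasis K ℂ H) (x : H) :
    HasSum (fun i => ‖⟪b i, x⟫_ℂ‖ ^ 2) (‖x‖ ^ 2) := by
  have h := (b.hasSum_inner_mul_inner x x).mapL Complex.reCLM
  convert h using 1
  · ext i
    rw [Complex.reCLM_apply, ← inner_conj_symm x (b i), mul_comm, Complex.mul_conj,
      Complex.normSq_eq_norm_sq, Complex.ofReal_re]
  · rw [Complex.reCLM_apply, inner_self_eq_norm_sq_to_K]
    norm_cast

theorem tsum_overlap (b : HilbertBasis K ℂ H) (x : H) :
    ∑' i, overlap (b i) x = ENNReal.ofReal (‖x‖ ^ 2) := by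
  rw [← (hasSum_norm_inner_sq b x).tsum_eq]
  exact (ENNReal.ofReal_tsum_of_nonneg (fun _ => by positivity)
    (hasSum_norm_inner_sq b x).summable).symm

theorem tsum_overlap' (b : HilbertBasis K ℂ H) (x : H) :
    ∑' i, overlap x (b i) = ENNReal.ofReal (‖x‖ ^ 2) := by
  simp_rw [overlap_comm x]; exact tsum_overlap b x

end

/-- The basis `bᵢ ⊗ |n⟩` of the joint space. -/
theorem exists_productBasis (ι : Type v) {K : Type*} (b : HilbertBasis K ℂ (Hilb κ)) :
    ∃ e : HilbertBasis (K × ι) ℂ (Hilb (κ × ι)), ∀ z, e z = tmul (b z.1) (ket z.2) := by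
  classical
  have ho : Orthonormal ℂ fun z : K × ι => tmul (b z.1) (ket z.2) := by
    rw [orthonormal_iff_ite]
    rintro ⟨i, n⟩ ⟨j, m⟩
    rw [inner_tmul, inner_ket_ket, orthonormal_iff_ite.1 b.orthonormal]
    by_cases h : i = j <;> by_cases h' : n = m <;> simp [h, h']
  refine ⟨HilbertBasis.mkOfOrthogonalEqBot ho ?_,
    fun z => congrFun (HilbertBasis.coe_mkOfOrthogonalEqBot ho _) z⟩
  rw [Submodule.eq_bot_iff]
  intro z hz
  -- Completeness: each slice (1 ⊗ ⟨n|)z is orthogonal to every `b i`, hence zero, and the slices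
  -- contain all coordinates of z.
  have hz' : ∀ n : ι, ContinuousLinearMap.adjoint (tensorRight (ket n)) z = (0 : Hilb κ) := by
    intro n
    rw [← b.repr.map_eq_zero_iff]
    ext i
    rw [b.repr_apply_apply, inner_adjoint_tensorRight]
    exact (Submodule.mem_orthogonal _ _).1 hz _ (Submodule.subset_span ⟨(i, n), rfl⟩)
  ext ⟨a, n⟩
  rw [← adjoint_tensorRight_ket_apply, hz' n]
  rfl

end Basics

/-! ### Positive trace-class operators: eigenbases and the trace formula for the entropy -/

section Spectral

variable {H : Type w} [NormedAddCommGroup H] [InnerProductSpace ℂ H] [CompleteSpace H] {K : Type*}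

/-- The operator norm is bounded by the Hilbert–Schmidt norm. -/
theorem norm_sq_le_of_tsum_le (b : HilbertBasis K ℂ H) (T : H →L[ℂ] H) {C : ℝ} (hC : 0 ≤ C)
    (h : ∑' i, ENNReal.ofReal (‖T (b i)‖ ^ 2) ≤ ENNReal.ofReal C) : ‖T‖ ^ 2 ≤ C := by
  -- Parseval is applied to T†y, whose coordinates ⟨T bᵢ, y⟩ are controlled by Cauchy–Schwarz.
  have key : ∀ y, ‖ContinuousLinearMap.adjoint T y‖ ^ 2 ≤ C * ‖y‖ ^ 2 := by
    intro y
    rw [← ENNReal.ofReal_le_ofReal_iff (by positivity), ← tsum_overlap b,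
      ENNReal.ofReal_mul hC]
    refine le_trans ?_ (mul_le_mul_left h _)
    rw [← ENNReal.tsum_mul_right]
    refine ENNReal.tsum_le_tsum fun i => ?_
    rw [overlap, ContinuousLinearMap.adjoint_inner_right, ← ENNReal.ofReal_mul (by positivity),
      ← mul_pow]
    exact ENNReal.ofReal_le_ofReal (by gcongr; exact norm_inner_le_norm _ _)
  have h2 : ‖T‖ ≤ √C := by
    rw [← LinearIsometryEquiv.norm_map ContinuousLinearMap.adjoint T]
    refine ContinuousLinearMap.opNorm_le_bound _ (Real.sqrt_nonneg _) fun y => ?_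
    rw [← abs_of_nonneg (norm_nonneg (ContinuousLinearMap.adjoint T y)),
      ← abs_of_nonneg (norm_nonneg y), ← Real.sqrt_sq_eq_abs, ← Real.sqrt_sq_eq_abs,
      ← Real.sqrt_mul hC]
    exact Real.sqrt_le_sqrt (key y)
  calc ‖T‖ ^ 2 ≤ √C ^ 2 := by gcongr
    _ = C := Real.sq_sqrt hC

/-- With S = √T one has ‖S(Sx)‖ ≤ ‖S‖‖Sx‖, where ‖S‖² = ‖T‖ and ‖Sx‖² = ⟨x, Tx⟩. Summed over a
basis, this bounds the Hilbert–Schmidt norm by the trace. -/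
theorem norm_sq_apply_le_of_isPositive {T : H →L[ℂ] H} (hT : T.IsPositive) (x : H) :
    ‖T x‖ ^ 2 ≤ ‖T‖ * (⟪x, T x⟫_ℂ).re := by
  have hT0 : 0 ≤ T := (ContinuousLinearMap.nonneg_iff_isPositive T).2 hT
  set S : H →L[ℂ] H := CFC.sqrt T with hS
  have hSS : S * S = T := CFC.sqrt_mul_sqrt_self T hT0
  have hSa : IsSelfAdjoint S := (CFC.sqrt_nonneg T).isSelfAdjoint
  have h1 : ‖T‖ = ‖S‖ * ‖S‖ := by
    rw [← hSS]
    nth_rewrite 1 [← hSa.star_eq]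
    exact CStarRing.norm_star_mul_self
  have h2 : (⟪x, T x⟫_ℂ).re = ‖S x‖ ^ 2 := by
    rw [← hSS, mul_apply_eq_comp, ← ContinuousLinearMap.adjoint_inner_left,
      ContinuousLinearMap.isSelfAdjoint_iff'.1 hSa, inner_self_eq_norm_sq_to_K]
    norm_cast
  rw [h1, h2, ← hSS, mul_apply_eq_comp]
  calc ‖S (S x)‖ ^ 2 ≤ (‖S‖ * ‖S x‖) ^ 2 := by gcongr; exact S.le_opNorm _
    _ = _ := by ring

theorem norm_le_of_tsum_diag_le (b : HilbertBasis K ℂ H) {T : H →L[ℂ] H} (hT : T.IsPositive)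
    {C : ℝ} (hC : 0 ≤ C)
    (h : ∑' i, ENNReal.ofReal (⟪b i, T (b i)⟫_ℂ).re ≤ ENNReal.ofReal C) : ‖T‖ ≤ C := by
  have h1 : ‖T‖ ^ 2 ≤ ‖T‖ * C := by
    refine norm_sq_le_of_tsum_le b T (by positivity) ?_
    rw [ENNReal.ofReal_mul (norm_nonneg _)]
    refine le_trans ?_ (mul_le_mul_right h _)
    rw [← ENNReal.tsum_mul_left]
    refine ENNReal.tsum_le_tsum fun i => ?_
    rw [← ENNReal.ofReal_mul (norm_nonneg _)]
    exact ENNReal.ofReal_le_ofReal (norm_sq_apply_le_of_isPositive hT _)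
  rcases (norm_nonneg T).eq_or_lt with h0 | h0
  · rw [← h0]; exact hC
  · rw [sq] at h1
    exact le_of_mul_le_mul_left h1 h0

/-- T is a norm limit of finite-rank truncations: the squared Hilbert–Schmidt norm of the remainder
is at most ‖T‖ times the tail of the trace. -/
theorem isCompactOperator_of_tsum_diag_ne_top (b : HilbertBasis K ℂ H) {T : H →L[ℂ] H}
    (hT : T.IsPositive) (h : ∑' i, ENNReal.ofReal (⟪b i, T (b i)⟫_ℂ).re ≠ ⊤) :
    IsCompactOperator T := by
  classical
  let F : Finset K → H →L[ℂ] H := fun s =>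
    ∑ i ∈ s, InnerProductSpace.rankOne ℂ (T (b i)) (b i)
  have hFb : ∀ s j, F s (b j) = if j ∈ s then T (b j) else 0 := by
    intro s j
    simp [F, orthonormal_iff_ite.1 b.orthonormal]
  have hF : ∀ s, IsCompactOperator (F s) := by
    intro s
    refine Submodule.sum_mem (compactOperator (RingHom.id ℂ) H H) (t := s)
      (f := fun i => InnerProductSpace.rankOne ℂ (T (b i)) (b i)) fun i _ => ?_
    change IsCompactOperator (InnerProductSpace.rankOne ℂ (T (b i)) (b i) : H →L[ℂ] H)
    rw [InnerProductSpace.rankOne_def']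
    have : IsCompactOperator (ContinuousLinearMap.toSpanSingleton ℂ (T (b i))) :=
      isCompactOperator_of_locallyCompactSpace_rng _
    exact this.comp_clm _
  refine isCompactOperator_of_tendsto (l := atTop) (F := F) ?_ (.of_forall hF)
  rw [tendsto_iff_norm_sub_tendsto_zero]
  have htail := ENNReal.tendsto_tsum_compl_atTop_zero h
  set g : Finset K → ℝ≥0∞ :=
    fun s => ∑' i : { x // x ∉ s }, ENNReal.ofReal (⟪b i, T (b i)⟫_ℂ).re with hg
  have hgt : ∀ s, g s ≠ ⊤ := fun s =>
    ne_top_of_le_ne_top h (ENNReal.tsum_comp_le_tsum_of_injective Subtype.val_injective _)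
  have hbound : ∀ s, ‖F s - T‖ ^ 2 ≤ ‖T‖ * (g s).toReal := by
    intro s
    refine norm_sq_le_of_tsum_le b _ (by positivity) ?_
    rw [ENNReal.ofReal_mul (norm_nonneg _), ENNReal.ofReal_toReal (hgt s), hg,
      ← ENNReal.tsum_mul_left]
    rw [← tsum_subtype_eq_of_support_subset (s := {x | x ∉ s})]
    · refine ENNReal.tsum_le_tsum fun i => ?_
      rw [← ENNReal.ofReal_mul (norm_nonneg _)]
      refine ENNReal.ofReal_le_ofReal ?_
      rw [sub_apply, hFb, if_neg i.2, zero_sub, norm_neg]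
      exact norm_sq_apply_le_of_isPositive hT _
    · intro i hi hmem
      refine hi ?_
      have hmem' : i ∈ s := hmem
      simp [hFb, hmem']
  have hlim : Tendsto (fun s => ‖T‖ * (g s).toReal) atTop (𝓝 0) := by
    have := (ENNReal.tendsto_toReal (by simp)).comp htail
    simpa using this.const_mul ‖T‖
  have hsq : Tendsto (fun s => ‖F s - T‖ ^ 2) atTop (𝓝 0) :=
    squeeze_zero (fun _ => by positivity) hbound hlim
  have := (Real.continuous_sqrt.tendsto 0).comp hsq
  simpa [Function.comp_def, Real.sqrt_sq] using this

/-- A positive operator with finite trace has an orthonormal basis of eigenvectors. -/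
theorem exists_eigenbasis (b : HilbertBasis K ℂ H) {T : H →L[ℂ] H}
    (hT : T.IsPositive) (h : ∑' i, ENNReal.ofReal (⟪b i, T (b i)⟫_ℂ).re ≠ ⊤) :
    ∃ (J : Type w) (e : HilbertBasis J ℂ H) (s : J → ℝ),
      (∀ j, 0 ≤ s j) ∧ ∀ j, T (e j) = (s j : ℂ) • e j := by
  have hc := isCompactOperator_of_tsum_diag_ne_top b hT h
  have hsym := hT.isSymmetric
  have hbot := ContinuousLinearMap.orthogonalComplement_iSup_eigenspaces_eq_bot hc hsym
  have hcl : ∀ μ : ℂ, CompleteSpace (Module.End.eigenspace (T : H →ₗ[ℂ] H) μ) := fun μ => by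
    have : IsClosed (Module.End.eigenspace (T : H →ₗ[ℂ] H) μ : Set H) := by
      have h2 : (Module.End.eigenspace (T : H →ₗ[ℂ] H) μ : Set H) = {x | T x = μ • x} := by
        ext x; simp
      rw [h2]
      exact isClosed_eq T.continuous (continuous_const_smul μ)
    exact this.completeSpace_coe
  -- A basis is chosen in every eigenspace; for μ that is not an eigenvalue it is empty, so gluing
  -- over all μ ∈ ℂ is harmless.
  choose w f hf using fun μ : ℂ =>
    exists_hilbertBasis (𝕜 := ℂ) (E := Module.End.eigenspace (T : H →ₗ[ℂ] H) μ)
  have ho := hsym.orthogonalFamily_eigenspaces.orthonormal_sigma_orthonormal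
    (v_family := fun μ => (f μ)) (fun μ => (f μ).orthonormal)
  have hperp : (Submodule.span ℂ (Set.range fun j : Σ μ, w μ => (f j.1 j.2 : H)))ᗮ = ⊥ := by
    rw [Submodule.eq_bot_iff]
    intro x hx
    have : x ∈ (⨆ μ, Module.End.eigenspace (T : H →ₗ[ℂ] H) μ)ᗮ := by
      rw [← Submodule.iInf_orthogonal, Submodule.mem_iInf]
      intro μ
      have hd := (f μ).dense_span
      rw [Submodule.mem_orthogonal]
      intro y hy
      have hy' : (⟨y, hy⟩ : Module.End.eigenspace (T : H →ₗ[ℂ] H) μ) ∈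
          (Submodule.span ℂ (Set.range (f μ))).topologicalClosure := by rw [hd]; trivial
      have hsub : (Submodule.span ℂ (Set.range (f μ))).topologicalClosure ≤
          LinearMap.ker ((innerSL ℂ x).toLinearMap ∘ₗ
            (Module.End.eigenspace (T : H →ₗ[ℂ] H) μ).subtype) := by
        refine Submodule.topologicalClosure_minimal _ ?_ ?_
        · rw [Submodule.span_le]
          rintro _ ⟨i, rfl⟩
          have := (Submodule.mem_orthogonal' _ _).1 hx _ (Submodule.subset_span ⟨⟨μ, i⟩, rfl⟩)
          simpa using this
        · exact ((innerSL ℂ x).comp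
            (Module.End.eigenspace (T : H →ₗ[ℂ] H) μ).subtypeL).isClosed_ker
      have := hsub hy'
      exact inner_eq_zero_symm.1 (by simpa using this)
    rw [hbot] at this
    exact (Submodule.mem_bot ℂ).1 this
  refine ⟨Σ μ, w μ, HilbertBasis.mkOfOrthogonalEqBot ho hperp, fun j => j.1.re, ?_, ?_⟩
  all_goals
    intro j
    have hj : HilbertBasis.mkOfOrthogonalEqBot ho hperp j = (f j.1 j.2 : H) :=
      congrFun (HilbertBasis.coe_mkOfOrthogonalEqBot ho _) j
    have hTj : T (f j.1 j.2 : H) = j.1 • (f j.1 j.2 : H) :=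
      Module.End.mem_eigenspace_iff.1 (f j.1 j.2).2
    have hn : ‖(f j.1 j.2 : H)‖ = 1 := ho.1 j
    -- Positivity forces the eigenvalue to be real and nonnegative, so its real part loses nothing.
    have hpos := hT.inner_nonneg_right (f j.1 j.2 : H)
    rw [hTj, inner_smul_right, inner_self_eq_norm_sq_to_K, hn] at hpos
    simp only [Complex.coe_algebraMap, Complex.ofReal_one, one_pow, mul_one] at hpos
  · exact (Complex.nonneg_iff.1 hpos).1
  · rw [hj, hTj]
    congr 1
    exact Complex.ext (by simp) (by simpa using (Complex.nonneg_iff.1 hpos).2.symm)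

/-- The continuous functional calculus acts on eigenvectors by evaluation. -/
theorem cfc_apply_eigenvector {T : H →L[ℂ] H} (hT : IsSelfAdjoint T) {f : ℝ → ℝ}
    (hf : Continuous f) {μ : ℝ} {x : H} (hx : T x = (μ : ℂ) • x) :
    cfc f T x = ((f μ : ℝ) : ℂ) • x := by
  by_cases hx0 : x = 0
  · simp [hx0]
  have hμ : μ ∈ spectrum ℝ T := by
    rw [spectrum.mem_iff]
    intro hu
    obtain ⟨v, hv⟩ := hu
    have h0 : (v : H →L[ℂ] H) x = 0 := by
      rw [hv, sub_apply, hx]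
      simp [Algebra.algebraMap_eq_smul_one]
    have h1 : ((v⁻¹ : (H →L[ℂ] H)ˣ) : H →L[ℂ] H) ((v : H →L[ℂ] H) x) = x := by
      rw [← mul_apply_eq_comp, Units.inv_mul, one_apply_eq_self]
    rw [h0, map_zero] at h1
    exact hx0 h1.symm
  rw [cfc_apply f T hT hf.continuousOn]
  -- Stone–Weierstrass: the functions g with this property form a closed subalgebra containing the
  -- constants and the identity.
  have key : ∀ g : C(spectrum ℝ T, ℝ), cfcHom hT g x = ((g ⟨μ, hμ⟩ : ℝ) : ℂ) • x := by
    intro g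
    induction g using ContinuousMap.induction_on_of_compact with
    | const r =>
      have : cfcHom hT (ContinuousMap.const _ r) = algebraMap ℝ (H →L[ℂ] H) r :=
        AlgHomClass.commutes (cfcHom hT) r
      rw [this]
      simp [Algebra.algebraMap_eq_smul_one]
    | id =>
      rw [cfcHom_id (R := ℝ) hT]
      simpa using hx
    | star_id =>
      rw [map_star]
      rw [cfcHom_id (R := ℝ) hT, hT.star_eq]
      simpa using hx
    | add f g hf hg => rw [map_add, add_apply, hf, hg, ← add_smul]; simp
    | mul f g hf hg =>
      rw [map_mul, mul_apply_eq_comp, hg, map_smul, hf, smul_smul]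
      simp [mul_comm]
    | frequently f hf =>
      have hcl : IsClosed {g : C(spectrum ℝ T, ℝ) |
          cfcHom hT g x = ((g ⟨μ, hμ⟩ : ℝ) : ℂ) • x} := by
        refine isClosed_eq ?_ ?_
        · exact (ContinuousLinearMap.apply ℂ H x).continuous.comp (cfcHom_continuous hT)
        · exact (Complex.continuous_ofReal.comp
            (continuous_eval_const _)).smul continuous_const
      exact hcl.mem_of_frequently_of_tendsto hf tendsto_id
  exact key _

theorem ofReal_inner_of_eigenbasis (e : HilbertBasis K ℂ H) {T : H →L[ℂ] H}
    (hT : IsSelfAdjoint T) {s : K → ℝ} (hs : ∀ j, 0 ≤ s j)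
    (h : ∀ j, T (e j) = (s j : ℂ) • e j) (x : H) :
    ENNReal.ofReal (⟪x, T x⟫_ℂ).re = ∑' j, ENNReal.ofReal (s j) * overlap (e j) x := by
  have h1 : HasSum (fun j => s j * ‖⟪e j, x⟫_ℂ‖ ^ 2) (⟪x, T x⟫_ℂ).re := by
    have h := (e.hasSum_inner_mul_inner x (T x)).mapL Complex.reCLM
    rw [Complex.reCLM_apply] at h
    convert h using 1
    ext j
    rw [Complex.reCLM_apply, ← ContinuousLinearMap.adjoint_inner_left,
      ContinuousLinearMap.isSelfAdjoint_iff'.1 hT, ‹∀ j, T (e j) = _› j, inner_smul_left,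
      ← inner_conj_symm x (e j), mul_left_comm, mul_comm ((starRingEnd ℂ) ⟪e j, x⟫_ℂ),
      Complex.mul_conj, Complex.normSq_eq_norm_sq, Complex.conj_ofReal, ← Complex.ofReal_mul,
      Complex.ofReal_re]
  rw [← h1.tsum_eq, ENNReal.ofReal_tsum_of_nonneg (fun j => by have := hs j; positivity)
    h1.summable]
  exact tsum_congr fun j => by rw [ENNReal.ofReal_mul (hs j), overlap]

/-- Basis independence of the trace: both sides are the same double sum of eigenvalues times
overlaps, and in `ℝ≥0∞` the order of summation is free. Applied to η(ϱ), it moves the entropy from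
the standard basis to an eigenbasis. -/
theorem tsum_inner_of_eigenbasis {I : Type*} (b : HilbertBasis I ℂ H) (e : HilbertBasis K ℂ H)
    {T : H →L[ℂ] H} (hT : IsSelfAdjoint T) {s : K → ℝ} (hs : ∀ j, 0 ≤ s j)
    (h : ∀ j, T (e j) = (s j : ℂ) • e j) :
    ∑' i, ENNReal.ofReal (⟪b i, T (b i)⟫_ℂ).re = ∑' j, ENNReal.ofReal (s j) := by
  simp_rw [ofReal_inner_of_eigenbasis e hT hs h]
  rw [ENNReal.tsum_comm]
  refine tsum_congr fun j => ?_
  rw [ENNReal.tsum_mul_left, ← mul_one (ENNReal.ofReal (s j))]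
  simp_rw [mul_one]
  simp_rw [overlap_comm (e j)]
  rw [tsum_overlap, e.orthonormal.1 j]
  simp

theorem isState_iff {κ : Type u} {ρ : Hilb κ →L[ℂ] Hilb κ} (hρ : ρ.IsPositive) :
    IsState ρ ↔ ∑' a, ENNReal.ofReal (⟪ket a, ρ (ket a)⟫_ℂ).re = 1 := by
  have hnn := fun a => Complex.nonneg_iff.1 (hρ.inner_nonneg_right (ket a))
  have hre : (fun a => ⟪ket a, ρ (ket a)⟫_ℂ) = fun a => (((⟪ket a, ρ (ket a)⟫_ℂ).re : ℝ) : ℂ) := by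
    funext a
    exact Complex.ext (by simp) (by simpa using (hnn a).2.symm)
  constructor
  · intro h
    have h2 := h.2
    rw [hre] at h2
    have h3 : HasSum (fun a => (⟪ket a, ρ (ket a)⟫_ℂ).re) 1 := by simpa using h2.mapL Complex.reCLM
    rw [← ENNReal.ofReal_tsum_of_nonneg (fun a => (hnn a).1) h3.summable, h3.tsum_eq]
    simp
  · intro h
    refine ⟨hρ, ?_⟩
    rw [hre]
    have hs : Summable fun a => (⟪ket a, ρ (ket a)⟫_ℂ).re := by
      have := ENNReal.summable_toReal (h ▸ ENNReal.one_ne_top)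
      simpa [ENNReal.toReal_ofReal (hnn _).1] using this
    rw [← ENNReal.ofReal_tsum_of_nonneg (fun a => (hnn a).1) hs, ENNReal.ofReal_eq_one] at h
    have := hs.hasSum.mapL Complex.ofRealCLM
    rw [h] at this
    simpa using this

theorem entropy_eq {κ : Type u} {ρ : Hilb κ →L[ℂ] Hilb κ} (hT : IsSelfAdjoint ρ)
    (e : HilbertBasis K ℂ (Hilb κ)) {s : K → ℝ} (hs : ∀ j, 0 ≤ s j) (hs1 : ∀ j, s j ≤ 1)
    (h : ∀ j, ρ (e j) = (s j : ℂ) • e j) :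
    entropy ρ = ∑' j, ENNReal.ofReal (Real.negMulLog (s j)) := by
  have := tsum_inner_of_eigenbasis (ketBasis κ) e (T := negMulLogOp ρ)
    (cfc_predicate _ _) (s := fun j => Real.negMulLog (s j))
    (fun j => Real.negMulLog_nonneg (hs j) (hs1 j))
    (fun j => cfc_apply_eigenvector hT Real.continuous_negMulLog (h j))
  simp_rw [ketBasis_apply] at this
  exact this

/-- Spectral decomposition of a state. -/
theorem IsState.exists_eigenbasis {κ : Type u} {ρ : Hilb κ →L[ℂ] Hilb κ} (hρ : IsState ρ) :
    ∃ (K : Type u) (e : HilbertBasis K ℂ (Hilb κ)) (s : K → ℝ),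
      (∀ j, 0 ≤ s j) ∧ (∀ j, s j ≤ 1) ∧ ∑' j, ENNReal.ofReal (s j) = 1 ∧
      (∀ j, ρ (e j) = (s j : ℂ) • e j) ∧
      entropy ρ = ∑' j, ENNReal.ofReal (Real.negMulLog (s j)) := by
  have htr := (isState_iff hρ.1).1 hρ
  have htr' : ∑' a, ENNReal.ofReal (⟪ketBasis κ a, ρ (ketBasis κ a)⟫_ℂ).re = 1 := by
    simpa only [ketBasis_apply] using htr
  obtain ⟨K, e, s, hs, he⟩ := LandauerCooling.exists_eigenbasis (ketBasis κ) hρ.1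
    (htr' ▸ ENNReal.one_ne_top)
  have hsum : ∑' j, ENNReal.ofReal (s j) = 1 := by
    rw [← tsum_inner_of_eigenbasis (ketBasis κ) e hρ.1.isSelfAdjoint hs he, htr']
  have hs1 : ∀ j, s j ≤ 1 := fun j => by
    have := ENNReal.le_tsum (f := fun j => ENNReal.ofReal (s j)) j
    rw [hsum] at this
    exact ENNReal.ofReal_le_one.1 this
  exact ⟨K, e, s, hs, hs1, hsum, he, entropy_eq hρ.1.isSelfAdjoint e hs hs1 he⟩

end Spectral

/-! ### Operator-norm convergent sums of conjugated positive operators -/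

section ConjSum

theorem inner_tsum_apply {H I : Type*} [NormedAddCommGroup H] [InnerProductSpace ℂ H]
    {T : I → H →L[ℂ] H} (hT : Summable T) (x y : H) :
    HasSum (fun i => ⟪x, T i y⟫_ℂ) ⟪x, (∑' i, T i) y⟫_ℂ :=
  (hT.hasSum.mapL (ContinuousLinearMap.apply ℂ H y)).mapL (innerSL ℂ x)

variable {G H : Type*} [NormedAddCommGroup G] [InnerProductSpace ℂ G] [CompleteSpace G]
  [NormedAddCommGroup H] [InnerProductSpace ℂ H] [CompleteSpace H] {I K : Type*}

theorem inner_conj_apply (A : G →L[ℂ] H) (R : H →L[ℂ] H) (x y : G) :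
    ⟪x, (ContinuousLinearMap.adjoint A ∘L R ∘L A) y⟫_ℂ = ⟪A x, R (A y)⟫_ℂ := by
  rw [ContinuousLinearMap.comp_apply, ContinuousLinearMap.comp_apply,
    ContinuousLinearMap.adjoint_inner_right]

theorem isPositive_conj (A : G →L[ℂ] H) {R : H →L[ℂ] H} (hR : R.IsPositive) :
    (ContinuousLinearMap.adjoint A ∘L R ∘L A).IsPositive := by
  have := hR.conj_adjoint (ContinuousLinearMap.adjoint A)
  rwa [ContinuousLinearMap.adjoint_adjoint] at this

theorem isPositive_tsum {T : I → H →L[ℂ] H} (hT : ∀ i, (T i).IsPositive) :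
    (∑' i, T i).IsPositive := by
  rw [← ContinuousLinearMap.nonneg_iff_isPositive]
  exact tsum_nonneg fun i => (ContinuousLinearMap.nonneg_iff_isPositive _).2 (hT i)

omit [CompleteSpace H] in
theorem ofReal_inner_tsum {T : I → H →L[ℂ] H} (hs : Summable T) (hT : ∀ i, (T i).IsPositive)
    (x : H) :
    ENNReal.ofReal (⟪x, (∑' i, T i) x⟫_ℂ).re = ∑' i, ENNReal.ofReal (⟪x, T i x⟫_ℂ).re := by
  have h : HasSum (fun i => (⟪x, T i x⟫_ℂ).re) (⟪x, (∑' i, T i) x⟫_ℂ).re := by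
    simpa using (inner_tsum_apply hs x x).mapL Complex.reCLM
  rw [← h.tsum_eq]
  exact ENNReal.ofReal_tsum_of_nonneg (fun i => (hT i).re_inner_nonneg_right x) h.summable

/-- The norm of a positive operator is at most its trace, so summable traces give norm summability.
This ensures that the `tsum` defining a partial trace is a genuine limit and not the default value
0. -/
theorem summable_conj (b : HilbertBasis K ℂ G) (A : I → G →L[ℂ] H) {R : H →L[ℂ] H}
    (hR : R.IsPositive)
    (h : ∑' i, ∑' a, ENNReal.ofReal (⟪A i (b a), R (A i (b a))⟫_ℂ).re ≠ ⊤) :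
    Summable fun i => ContinuousLinearMap.adjoint (A i) ∘L R ∘L A i := by
  refine Summable.of_norm_bounded (ENNReal.summable_toReal h) fun i => ?_
  refine norm_le_of_tsum_diag_le b (isPositive_conj (A i) hR) ENNReal.toReal_nonneg ?_
  rw [ENNReal.ofReal_toReal (ENNReal.ne_top_of_tsum_ne_top h i)]
  simp_rw [inner_conj_apply]
  exact le_rfl

end ConjSum

/-! ### Partial traces of positive operators of finite trace -/

section PartialTrace

variable {κ : Type u} {ι : Type v} {R : Hilb (κ × ι) →L[ℂ] Hilb (κ × ι)}

/-- The trace of a positive operator, in the standard basis. -/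
noncomputable def posTrace {κ : Type u} (R : Hilb κ →L[ℂ] Hilb κ) : ℝ≥0∞ :=
  ∑' a, ENNReal.ofReal (⟪ket a, R (ket a)⟫_ℂ).re

theorem posTrace_prod (R : Hilb (κ × ι) →L[ℂ] Hilb (κ × ι)) :
    posTrace R = ∑' (a : κ) (n : ι), ENNReal.ofReal (⟪ket (a, n), R (ket (a, n))⟫_ℂ).re :=
  ENNReal.tsum_prod'

theorem summable_traceMachine (hR : R.IsPositive) (h : posTrace R ≠ ⊤) :
    Summable fun n : ι => ContinuousLinearMap.adjoint (tensorRight (κ := κ) (ket n)) ∘L R ∘L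
      tensorRight (ket n) := by
  refine summable_conj (ketBasis κ) (fun n : ι => tensorRight (ket n)) hR ?_
  simp_rw [ketBasis_apply, tensorRight_apply, tmul_ket_ket]
  rwa [ENNReal.tsum_comm, ← posTrace_prod]

theorem summable_traceTarget (hR : R.IsPositive) (h : posTrace R ≠ ⊤) :
    Summable fun a : κ => ContinuousLinearMap.adjoint (tensorLeft (ι := ι) (ket a)) ∘L R ∘L
      tensorLeft (ket a) := by
  refine summable_conj (ketBasis ι) (fun a : κ => tensorLeft (ket a)) hR ?_
  simp_rw [ketBasis_apply, tensorLeft_apply, tmul_ket_ket]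
  rwa [← posTrace_prod]

theorem isPositive_traceMachine (hR : R.IsPositive) : (traceMachine R).IsPositive :=
  isPositive_tsum fun _ => isPositive_conj _ hR

theorem isPositive_traceTarget (hR : R.IsPositive) : (traceTarget R).IsPositive :=
  isPositive_tsum fun _ => isPositive_conj _ hR

theorem ofReal_inner_traceMachine (hR : R.IsPositive) (h : posTrace R ≠ ⊤) (x : Hilb κ) :
    ENNReal.ofReal (⟪x, traceMachine R x⟫_ℂ).re =
      ∑' n : ι, ENNReal.ofReal (⟪tmul x (ket n), R (tmul x (ket n))⟫_ℂ).re := by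
  rw [traceMachine, ofReal_inner_tsum (summable_traceMachine hR h) fun _ => isPositive_conj _ hR]
  simp_rw [inner_conj_apply, tensorRight_apply]

theorem ofReal_inner_traceTarget (hR : R.IsPositive) (h : posTrace R ≠ ⊤) (v : Hilb ι) :
    ENNReal.ofReal (⟪v, traceTarget R v⟫_ℂ).re =
      ∑' a : κ, ENNReal.ofReal (⟪tmul (ket a) v, R (tmul (ket a) v)⟫_ℂ).re := by
  rw [traceTarget, ofReal_inner_tsum (summable_traceTarget hR h) fun _ => isPositive_conj _ hR]
  simp_rw [inner_conj_apply, tensorLeft_apply]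

theorem posTrace_traceMachine (hR : R.IsPositive) (h : posTrace R ≠ ⊤) :
    posTrace (traceMachine R) = posTrace R := by
  rw [posTrace_prod, posTrace]
  simp_rw [ofReal_inner_traceMachine hR h, tmul_ket_ket]

end PartialTrace

/-! ### Gibbs weights, the joint states and their populations -/

section Gibbs

variable {κ : Type u} {ι : Type v} {β : ℝ} {ω : ι → ℝ}

theorem partitionFn_pos [Nonempty ι] (h : Summable fun n => Real.exp (-β * ω n)) :
    0 < partitionFn β ω :=
  h.tsum_pos (fun _ => (Real.exp_pos _).le) (Classical.arbitrary ι) (Real.exp_pos _)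

theorem gibbsWeight_pos [Nonempty ι] (h : Summable fun n => Real.exp (-β * ω n)) (n : ι) :
    0 < gibbsWeight β ω n := div_pos (Real.exp_pos _) (partitionFn_pos h)

theorem hasSum_gibbsWeight [Nonempty ι] (h : Summable fun n => Real.exp (-β * ω n)) :
    HasSum (gibbsWeight β ω) 1 := by
  have := h.hasSum.div_const (partitionFn β ω)
  rwa [← partitionFn, div_self (partitionFn_pos h).ne'] at this

theorem gibbsWeight_le_one [Nonempty ι] (h : Summable fun n => Real.exp (-β * ω n)) (n : ι) :
    gibbsWeight β ω n ≤ 1 :=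
  le_hasSum (hasSum_gibbsWeight h) n fun m _ => (gibbsWeight_pos h m).le

/-- The bridge between entropy and energy: cross entropies relative to the Gibbs weights are affine
in the mean energy. -/
theorem log_gibbsWeight [Nonempty ι] (h : Summable fun n => Real.exp (-β * ω n)) (n : ι) :
    -Real.log (gibbsWeight β ω n) = β * ω n + Real.log (partitionFn β ω) := by
  rw [gibbsWeight, Real.log_div (Real.exp_pos _).ne' (partitionFn_pos h).ne', Real.log_exp]
  ring

theorem summable_initialState [Nonempty ι] (h : Summable fun n => Real.exp (-β * ω n))
    (ρ : Hilb κ →L[ℂ] Hilb κ) :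
    Summable fun n => (gibbsWeight β ω n : ℂ) •
      (tensorRight (ket n) ∘L ρ ∘L ContinuousLinearMap.adjoint (tensorRight (ket n))) := by
  refine Summable.of_norm_bounded ((hasSum_gibbsWeight h).summable.mul_right ‖ρ‖) fun n => ?_
  rw [norm_smul, Complex.norm_real, Real.norm_of_nonneg (gibbsWeight_pos h n).le]
  refine mul_le_mul_of_nonneg_left ?_ (gibbsWeight_pos h n).le
  have h1 : ‖(tensorRight (ket n) : Hilb κ →L[ℂ] _)‖ ≤ 1 :=
    (norm_tensorRight_le _).trans (norm_ket n).le
  calc _ ≤ ‖(tensorRight (ket n) : Hilb κ →L[ℂ] _)‖ *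
        (‖ρ‖ * ‖ContinuousLinearMap.adjoint (tensorRight (ket n) : Hilb κ →L[ℂ] _)‖) :=
        (ContinuousLinearMap.opNorm_comp_le _ _).trans
          (mul_le_mul_of_nonneg_left (ContinuousLinearMap.opNorm_comp_le _ _) (norm_nonneg _))
    _ ≤ 1 * (‖ρ‖ * 1) := by
        rw [LinearIsometryEquiv.norm_map]
        gcongr
    _ = ‖ρ‖ := by ring

theorem isPositive_initialState [Nonempty ι] (h : Summable fun n => Real.exp (-β * ω n))
    {ρ : Hilb κ →L[ℂ] Hilb κ} (hρ : ρ.IsPositive) : (initialState β ω ρ).IsPositive :=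
  isPositive_tsum fun n =>
    (hρ.conj_adjoint _).smul_of_nonneg (by exact_mod_cast (gibbsWeight_pos h n).le)

theorem initialState_tmul [Nonempty ι] (h : Summable fun n => Real.exp (-β * ω n))
    (ρ : Hilb κ →L[ℂ] Hilb κ) (x : Hilb κ) (n : ι) :
    initialState β ω ρ (tmul x (ket n)) = (gibbsWeight β ω n : ℂ) • tmul (ρ x) (ket n) := by
  classical
  have h1 := (summable_initialState h ρ).hasSum.mapL
    (ContinuousLinearMap.apply ℂ _ (tmul x (ket n)))
  refine h1.unique ?_
  convert hasSum_ite_eq n ((gibbsWeight β ω n : ℂ) • tmul (ρ x) (ket n)) using 2 with m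
  rw [ContinuousLinearMap.apply_apply, smul_apply,
    ContinuousLinearMap.comp_apply, ContinuousLinearMap.comp_apply, adjoint_tensorRight_tmul,
    inner_ket_ket, tensorRight_apply]
  split_ifs with hm
  · rw [hm, one_smul]
  · rw [zero_smul, map_zero, ← tensorRight_apply, map_zero, smul_zero]

theorem gibbsState_inner [Nonempty ι] (h : Summable fun n => Real.exp (-β * ω n)) (n : ι) :
    ⟪ket n, gibbsState β ω (ket n)⟫_ℂ = gibbsWeight β ω n := by
  classical
  have hs : Summable fun n => (gibbsWeight β ω n : ℂ) •
      InnerProductSpace.rankOne ℂ (ket n) (ket n) := by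
    refine Summable.of_norm_bounded (hasSum_gibbsWeight h).summable fun n => ?_
    rw [norm_smul, Complex.norm_real, Real.norm_of_nonneg (gibbsWeight_pos h n).le,
      InnerProductSpace.norm_rankOne, norm_ket, mul_one, mul_one]
  refine (inner_tsum_apply hs _ _).unique ?_
  convert hasSum_ite_eq n (gibbsWeight β ω n : ℂ) using 2 with m
  rw [smul_apply, InnerProductSpace.rankOne_apply, inner_ket_ket,
    inner_smul_right, inner_smul_right, inner_ket_ket]
  by_cases hm : m = n
  · simp [hm]
  · simp [hm]

variable {K : Type u} {e : HilbertBasis K ℂ (Hilb κ)} {s : K → ℝ} {ρ : Hilb κ →L[ℂ] Hilb κ}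
  (U : unitary (Hilb (κ × ι) →L[ℂ] Hilb (κ × ι)))

theorem isPositive_finalState [Nonempty ι] (h : Summable fun n => Real.exp (-β * ω n))
    (hρ : ρ.IsPositive) : (finalState β ω ρ U).IsPositive :=
  (isPositive_initialState h hρ).conj_adjoint _

theorem norm_unitary_apply {H : Type*} [NormedAddCommGroup H] [InnerProductSpace ℂ H]
    [CompleteSpace H] (U : unitary (H →L[ℂ] H)) (x : H) : ‖(U : H →L[ℂ] H) x‖ = ‖x‖ :=
  (Unitary.linearIsometryEquiv U).norm_map x

theorem norm_adjoint_unitary_apply {H : Type*} [NormedAddCommGroup H] [InnerProductSpace ℂ H]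
    [CompleteSpace H] (U : unitary (H →L[ℂ] H)) (x : H) :
    ‖ContinuousLinearMap.adjoint (U : H →L[ℂ] H) x‖ = ‖x‖ :=
  norm_unitary_apply (star U) x

/-- The populations of the final joint state. -/
theorem ofReal_inner_finalState [Nonempty ι] (h : Summable fun n => Real.exp (-β * ω n))
    (hρ : ρ.IsPositive) (hs : ∀ i, 0 ≤ s i) (he : ∀ i, ρ (e i) = (s i : ℂ) • e i)
    (x : Hilb (κ × ι)) :
    ENNReal.ofReal (⟪x, finalState β ω ρ U x⟫_ℂ).re =
      ∑' z : K × ι, ENNReal.ofReal (s z.1 * gibbsWeight β ω z.2) *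
        overlap ((U : Hilb (κ × ι) →L[ℂ] Hilb (κ × ι)) (tmul (e z.1) (ket z.2))) x := by
  obtain ⟨b, hb⟩ := exists_productBasis ι e
  have h1 : ⟪x, finalState β ω ρ U x⟫_ℂ =
      ⟪ContinuousLinearMap.adjoint (U : Hilb (κ × ι) →L[ℂ] Hilb (κ × ι)) x, initialState β ω ρ
        (ContinuousLinearMap.adjoint (U : Hilb (κ × ι) →L[ℂ] Hilb (κ × ι)) x)⟫_ℂ := by
    rw [ContinuousLinearMap.adjoint_inner_left]
    rfl
  rw [h1, ofReal_inner_of_eigenbasis b (isPositive_initialState h hρ).isSelfAdjoint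
    (s := fun z => s z.1 * gibbsWeight β ω z.2)
    (fun z => mul_nonneg (hs _) (gibbsWeight_pos h _).le)]
  · refine tsum_congr fun z => ?_
    rw [overlap, overlap, ContinuousLinearMap.adjoint_inner_right, hb]
  · intro z
    rw [hb, initialState_tmul h, he, ← tensorRight_apply, ← tensorRight_apply, map_smul,
      smul_smul, Complex.ofReal_mul, mul_comm]

theorem tsum_overlap_unitary {H : Type*} [NormedAddCommGroup H] [InnerProductSpace ℂ H]
    [CompleteSpace H] (U : unitary (H →L[ℂ] H)) {I : Type*} (b : HilbertBasis I ℂ H) (x : H) :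
    ∑' i, overlap ((U : H →L[ℂ] H) (b i)) x = ENNReal.ofReal (‖x‖ ^ 2) := by
  rw [← norm_adjoint_unitary_apply U, ← tsum_overlap b]
  refine tsum_congr fun i => ?_
  rw [overlap, overlap, ContinuousLinearMap.adjoint_inner_right]

theorem tsum_prod_weights {s : K → ℝ} {p : ι → ℝ} (hs : ∀ i, 0 ≤ s i)
    (hs1 : ∑' i, ENNReal.ofReal (s i) = 1) (hp1 : ∑' i, ENNReal.ofReal (p i) = 1) :
    ∑' z : K × ι, ENNReal.ofReal (s z.1 * p z.2) = 1 := by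
  rw [ENNReal.tsum_prod']
  simp_rw [ENNReal.ofReal_mul (hs _), ENNReal.tsum_mul_left, hp1, mul_one]
  exact hs1

theorem tsum_ofReal_gibbsWeight [Nonempty ι] (h : Summable fun n => Real.exp (-β * ω n)) :
    ∑' n, ENNReal.ofReal (gibbsWeight β ω n) = 1 := by
  rw [← ENNReal.ofReal_tsum_of_nonneg (fun n => (gibbsWeight_pos h n).le)
    (hasSum_gibbsWeight h).summable, (hasSum_gibbsWeight h).tsum_eq, ENNReal.ofReal_one]

theorem posTrace_finalState [Nonempty ι] (h : Summable fun n => Real.exp (-β * ω n))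
    (hρ : IsState ρ) : posTrace (finalState β ω ρ U) = 1 := by
  obtain ⟨K, e, s, hs, -, hs1, he, -⟩ := hρ.exists_eigenbasis
  simp_rw [posTrace, ofReal_inner_finalState U h hρ.1 hs he]
  rw [ENNReal.tsum_comm]
  simp_rw [ENNReal.tsum_mul_left, ← ketBasis_apply, tsum_overlap', norm_unitary_apply, norm_tmul,
    e.orthonormal.1, ketBasis_apply, norm_ket]
  simpa using tsum_prod_weights hs hs1 (tsum_ofReal_gibbsWeight h)

theorem isState_finalTarget [Nonempty ι] (h : Summable fun n => Real.exp (-β * ω n))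
    (hρ : IsState ρ) : IsState (finalTarget β ω ρ U) := by
  have h1 := posTrace_finalState U h hρ
  have h2 := isPositive_finalState U h hρ.1
  refine (isState_iff (isPositive_traceMachine h2)).2 ?_
  exact (posTrace_traceMachine h2 (h1 ▸ ENNReal.one_ne_top)).trans h1

end Gibbs

/-! ### Klein's inequality with a Hellinger remainder, for classical weights -/

section Classical

/-- Pointwise form of the bound of the relative entropy by the Hellinger distance. -/
theorem negMulLog_add_sq_le {r w : ℝ} (hr : 0 ≤ r) (hw : 0 ≤ w) (h : w = 0 → r = 0) :
    Real.negMulLog r + (√r - √w) ^ 2 + r ≤ r * -Real.log w + w := by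
  have h1 : (√r - √w) ^ 2 = r + w - 2 * (√r * √w) := by
    rw [sub_sq, Real.sq_sqrt hr, Real.sq_sqrt hw]; ring
  rw [h1, Real.negMulLog]
  rcases hr.eq_or_lt with rfl | hr0
  · simp
  have hw0 : 0 < w := lt_of_le_of_ne hw fun h' => hr0.ne' (h h'.symm)
  have hsr : 0 < √r := Real.sqrt_pos.2 hr0
  have hsw : 0 < √w := Real.sqrt_pos.2 hw0
  -- Applying log x ≤ x − 1 at x = √(w/r) instead of w/r is what produces the extra square; the
  -- factor 2 from log √ gives the cross term 2√(rw).
  have h2 := Real.log_le_sub_one_of_pos (div_pos hsw hsr)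
  rw [Real.log_div hsw.ne' hsr.ne', Real.log_sqrt hr, Real.log_sqrt hw] at h2
  have h3 : r * (√w / √r) = √r * √w := by
    field_simp
    rw [Real.sq_sqrt hr]
  nlinarith [mul_le_mul_of_nonneg_left h2 hr]

variable {A B : Type*} (D : A → B → ℝ≥0∞)

theorem tsum_tsum_mul_left_of_row (hD : ∀ a, ∑' b, D a b = 1) (f : A → ℝ≥0∞) :
    ∑' a, ∑' b, D a b * f a = ∑' a, f a :=
  tsum_congr fun a => by rw [ENNReal.tsum_mul_right, hD, one_mul]

theorem tsum_tsum_mul_of_col (hD : ∀ b, ∑' a, D a b = 1) (f : B → ℝ≥0∞) :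
    ∑' a, ∑' b, D a b * f b = ∑' b, f b := by
  rw [ENNReal.tsum_comm]
  exact tsum_congr fun b => by rw [ENNReal.tsum_mul_right, hD, one_mul]

/-- Klein's inequality for two spectra related by a doubly stochastic matrix. -/
theorem tsum_negMulLog_add_le (hD₁ : ∀ a, ∑' b, D a b = 1) (hD₂ : ∀ b, ∑' a, D a b = 1)
    {r : A → ℝ} {w : B → ℝ} (hr : ∀ a, 0 ≤ r a) (hr1 : ∀ a, r a ≤ 1)
    (hrs : ∑' a, ENNReal.ofReal (r a) = 1) (hw : ∀ b, 0 ≤ w b) (hw1 : ∀ b, w b ≤ 1)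
    (hws : ∑' b, ENNReal.ofReal (w b) = 1) (h0 : ∀ a b, w b = 0 → D a b = 0 ∨ r a = 0) :
    ∑' a, ENNReal.ofReal (Real.negMulLog (r a)) +
        ∑' a, ∑' b, D a b * ENNReal.ofReal ((√(r a) - √(w b)) ^ 2) ≤
      ∑' b, (∑' a, D a b * ENNReal.ofReal (r a)) * ENNReal.ofReal (-Real.log (w b)) := by
  have key : ∀ a b, D a b * ENNReal.ofReal (Real.negMulLog (r a)) +
      D a b * ENNReal.ofReal ((√(r a) - √(w b)) ^ 2) + D a b * ENNReal.ofReal (r a) ≤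
      D a b * ENNReal.ofReal (r a) * ENNReal.ofReal (-Real.log (w b)) +
        D a b * ENNReal.ofReal (w b) := by
    intro a b
    have hη := Real.negMulLog_nonneg (hr a) (hr1 a)
    have hl : 0 ≤ -Real.log (w b) := neg_nonneg.2 (Real.log_nonpos (hw b) (hw1 b))
    by_cases hDab : D a b = 0
    · simp [hDab]
    have h0' : w b = 0 → r a = 0 := fun h => (h0 a b h).resolve_left hDab
    rw [← mul_add, ← mul_add, mul_assoc, ← mul_add, ← ENNReal.ofReal_add hη (sq_nonneg _),
      ← ENNReal.ofReal_add (by positivity) (hr a), ← ENNReal.ofReal_mul (hr a),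
      ← ENNReal.ofReal_add (mul_nonneg (hr a) hl) (hw b)]
    refine mul_le_mul_right (ENNReal.ofReal_le_ofReal ?_) _
    exact negMulLog_add_sq_le (hr a) (hw b) h0'
  -- Unit row and column sums make the two linear terms equal to 1 each, so they cancel.
  have hsum := ENNReal.tsum_le_tsum fun a => ENNReal.tsum_le_tsum (key a)
  simp_rw [ENNReal.tsum_add] at hsum
  rw [tsum_tsum_mul_left_of_row D hD₁, tsum_tsum_mul_left_of_row D hD₁,
    tsum_tsum_mul_of_col D hD₂, hrs, hws] at hsum
  rw [ENNReal.add_le_add_iff_right ENNReal.one_ne_top] at hsum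
  refine hsum.trans (le_of_eq ?_)
  rw [ENNReal.tsum_comm]
  simp_rw [ENNReal.tsum_mul_right]

theorem le_one_of_tsum_ofReal {K : Type*} {s : K → ℝ} (h : ∑' i, ENNReal.ofReal (s i) = 1)
    (i : K) : s i ≤ 1 :=
  ENNReal.ofReal_le_one.1 (h ▸ ENNReal.le_tsum (f := fun i => ENNReal.ofReal (s i)) i)

theorem tsum_negMulLog_prod {K L : Type*} {s : K → ℝ} {p : L → ℝ} (hs : ∀ i, 0 ≤ s i)
    (hp : ∀ n, 0 ≤ p n) (hs1 : ∑' i, ENNReal.ofReal (s i) = 1)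
    (hp1 : ∑' n, ENNReal.ofReal (p n) = 1) :
    ∑' z : K × L, ENNReal.ofReal (Real.negMulLog (s z.1 * p z.2)) =
      ∑' i, ENNReal.ofReal (Real.negMulLog (s i)) + ∑' n, ENNReal.ofReal (Real.negMulLog (p n)) := by
  have hs' := le_one_of_tsum_ofReal hs1
  have hp' := le_one_of_tsum_ofReal hp1
  have : ∀ z : K × L, ENNReal.ofReal (Real.negMulLog (s z.1 * p z.2)) =
      ENNReal.ofReal (Real.negMulLog (s z.1)) * ENNReal.ofReal (p z.2) +
        ENNReal.ofReal (s z.1) * ENNReal.ofReal (Real.negMulLog (p z.2)) := by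
    intro z
    have h1 := Real.negMulLog_nonneg (hs z.1) (hs' z.1)
    have h2 := Real.negMulLog_nonneg (hp z.2) (hp' z.2)
    rw [Real.negMulLog_mul, ENNReal.ofReal_add (mul_nonneg (hp _) h1) (mul_nonneg (hs _) h2),
      mul_comm, ENNReal.ofReal_mul h1, ENNReal.ofReal_mul (hs _)]
  simp_rw [this]
  rw [ENNReal.tsum_add, ENNReal.tsum_prod', ENNReal.tsum_prod']
  simp_rw [ENNReal.tsum_mul_left, hp1, mul_one, ENNReal.tsum_mul_right, hs1, one_mul]

/-- The entropy balance of a bipartite system, in terms of the overlaps `D` of the final joint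
eigenbasis with a product basis. -/
theorem entropy_balance {K K' ι : Type*} (D : K × ι → K' × ι → ℝ≥0∞)
    (hD₁ : ∀ a, ∑' b, D a b = 1) (hD₂ : ∀ b, ∑' a, D a b = 1)
    {s : K → ℝ} {p : ι → ℝ} {s' : K' → ℝ} {q v : ι → ℝ}
    (hs : ∀ i, 0 ≤ s i) (hs1 : ∑' i, ENNReal.ofReal (s i) = 1)
    (hp : ∀ n, 0 ≤ p n) (hp1 : ∑' n, ENNReal.ofReal (p n) = 1)
    (hs' : ∀ i, 0 ≤ s' i) (hs1' : ∑' i, ENNReal.ofReal (s' i) = 1)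
    (hv : ∀ n, 0 ≤ v n) (hv1 : ∑' n, ENNReal.ofReal (v n) = 1)
    (hQs : ∀ j, ∑' l, ∑' a, D a (j, l) * ENNReal.ofReal (s a.1 * p a.2) = ENNReal.ofReal (s' j))
    (hQq : ∀ l, ∑' j, ∑' a, D a (j, l) * ENNReal.ofReal (s a.1 * p a.2) = ENNReal.ofReal (q l))
    (hvq : ∀ l, v l = 0 → q l = 0) :
    ∑' i, ENNReal.ofReal (Real.negMulLog (s i)) + ∑' n, ENNReal.ofReal (Real.negMulLog (p n)) +
        ∑' a, ∑' b, D a b * ENNReal.ofReal ((√(s a.1 * p a.2) - √(s' b.1 * v b.2)) ^ 2) ≤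
      ∑' j, ENNReal.ofReal (Real.negMulLog (s' j)) +
        ∑' l, ENNReal.ofReal (q l) * ENNReal.ofReal (-Real.log (v l)) := by
  have hs_le := le_one_of_tsum_ofReal hs1
  have hp_le := le_one_of_tsum_ofReal hp1
  have hs_le' := le_one_of_tsum_ofReal hs1'
  have hv_le := le_one_of_tsum_ofReal hv1
  -- A state is supported inside the product of its marginals' supports: a vanishing marginal forces
  -- all nonnegative terms that sum to it to vanish.
  have hzero : ∀ a b, s' b.1 * v b.2 = 0 → D a b = 0 ∨ s a.1 * p a.2 = 0 := by
    rintro a ⟨j, l⟩ h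
    have h1 : D a (j, l) * ENNReal.ofReal (s a.1 * p a.2) = 0 := by
      rcases mul_eq_zero.1 h with h | h
      · have h2 := hQs j
        simp only at h
        rw [h, ENNReal.ofReal_zero, ENNReal.tsum_eq_zero] at h2
        exact ENNReal.tsum_eq_zero.1 (h2 l) a
      · have h2 := hQq l
        rw [hvq l h, ENNReal.ofReal_zero, ENNReal.tsum_eq_zero] at h2
        exact ENNReal.tsum_eq_zero.1 (h2 j) a
    rcases mul_eq_zero.1 h1 with h1 | h1
    · exact .inl h1
    · exact .inr (le_antisymm (ENNReal.ofReal_eq_zero.1 h1) (mul_nonneg (hs _) (hp _)))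
  have hmain := tsum_negMulLog_add_le D hD₁ hD₂ (r := fun a => s a.1 * p a.2)
    (w := fun b => s' b.1 * v b.2) (fun a => mul_nonneg (hs _) (hp _))
    (fun a => mul_le_one₀ (hs_le _) (hp _) (hp_le _)) (tsum_prod_weights hs hs1 hp1)
    (fun b => mul_nonneg (hs' _) (hv _)) (fun b => mul_le_one₀ (hs_le' _) (hv _) (hv_le _))
    (tsum_prod_weights hs' hs1' hv1) hzero
  rw [tsum_negMulLog_prod hs hp hs1 hp1] at hmain
  refine hmain.trans ?_
  set Q : K' × ι → ℝ≥0∞ := fun b => ∑' a, D a b * ENNReal.ofReal (s a.1 * p a.2) with hQ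
  have hpt : ∀ b : K' × ι, Q b * ENNReal.ofReal (-Real.log (s' b.1 * v b.2)) ≤
      Q b * ENNReal.ofReal (-Real.log (s' b.1)) + Q b * ENNReal.ofReal (-Real.log (v b.2)) := by
    intro b
    by_cases h : s' b.1 * v b.2 = 0
    -- Here `Real.log 0 = 0`, so the left side is zero.
    · simp [h]
    · rw [← mul_add, Real.log_mul (left_ne_zero_of_mul h) (right_ne_zero_of_mul h), neg_add]
      gcongr
      exact ENNReal.ofReal_add_le
  refine (ENNReal.tsum_le_tsum hpt).trans (le_of_eq ?_)
  rw [ENNReal.tsum_add]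
  congr 1
  · rw [ENNReal.tsum_prod']
    refine tsum_congr fun j => ?_
    change ∑' l, Q (j, l) * ENNReal.ofReal (-Real.log (s' j)) = _
    rw [ENNReal.tsum_mul_right, hQ, hQs j, ← ENNReal.ofReal_mul (hs' j), Real.negMulLog,
      mul_neg, neg_mul]
  · rw [ENNReal.tsum_prod', ENNReal.tsum_comm]
    refine tsum_congr fun l => ?_
    change ∑' j, Q (j, l) * ENNReal.ofReal (-Real.log (v l)) = _
    rw [ENNReal.tsum_mul_right, hQ, hQq l]

end Classical

/-! ### Entropy balance of the process and the excess over the Landauer bound -/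

section Balance

variable {κ : Type u} {ι : Type v} {β : ℝ} {ω : ι → ℝ} {K K' : Type u}
  {e : HilbertBasis K ℂ (Hilb κ)} {s : K → ℝ} {e' : HilbertBasis K' ℂ (Hilb κ)} {s' : K' → ℝ}
  {ρ : Hilb κ →L[ℂ] Hilb κ} (U : unitary (Hilb (κ × ι) →L[ℂ] Hilb (κ × ι)))

/-- Overlaps of the evolved product basis `U (eᵢ ⊗ |n⟩)` with the product basis `e'ⱼ ⊗ |l⟩`. -/
noncomputable def finalOverlap (e : HilbertBasis K ℂ (Hilb κ)) (e' : HilbertBasis K' ℂ (Hilb κ))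
    (a : K × ι) (b : K' × ι) : ℝ≥0∞ :=
  overlap ((U : Hilb (κ × ι) →L[ℂ] Hilb (κ × ι)) (tmul (e a.1) (ket a.2)))
    (tmul (e' b.1) (ket b.2))

/-- The population of the energy level `n` in the final state of the machine. -/
noncomputable def finalPopulation (β : ℝ) (ω : ι → ℝ) (ρ : Hilb κ →L[ℂ] Hilb κ) (n : ι) : ℝ :=
  (⟪ket n, finalMachine β ω ρ U (ket n)⟫_ℂ).re

theorem norm_tmul_basis (e : HilbertBasis K ℂ (Hilb κ)) (i : K) (n : ι) :
    ‖tmul (e i) (ket n)‖ = 1 := by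
  rw [norm_tmul, norm_ket, e.orthonormal.1, one_mul]

theorem tsum_finalOverlap_row (a : K × ι) : ∑' b, finalOverlap U e e' a b = 1 := by
  obtain ⟨b, hb⟩ := exists_productBasis ι e'
  simp_rw [finalOverlap, ← hb]
  rw [tsum_overlap', norm_unitary_apply, norm_tmul_basis]
  simp

theorem tsum_finalOverlap_col (b : K' × ι) : ∑' a, finalOverlap U e e' a b = 1 := by
  obtain ⟨c, hc⟩ := exists_productBasis ι e
  simp_rw [finalOverlap, ← hc]
  rw [tsum_overlap_unitary, norm_tmul_basis]
  simp

theorem tsum_overlap_tmul (b : HilbertBasis K ℂ (Hilb κ)) (z : Hilb (κ × ι)) (l : ι) :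
    ∑' j, overlap z (tmul (b j) (ket l)) =
      ENNReal.ofReal (‖ContinuousLinearMap.adjoint (tensorRight (κ := κ) (ket l)) z‖ ^ 2) := by
  rw [← tsum_overlap b]
  refine tsum_congr fun j => ?_
  rw [overlap_comm, overlap, overlap, inner_adjoint_tensorRight]

variable [Nonempty ι] (h : Summable fun n => Real.exp (-β * ω n))
include h

theorem tsum_finalOverlap_target (hρ : IsState ρ) (hs : ∀ i, 0 ≤ s i)
    (he : ∀ i, ρ (e i) = (s i : ℂ) • e i)
    (he' : ∀ j, finalTarget β ω ρ U (e' j) = (s' j : ℂ) • e' j) (j : K') :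
    ∑' l, ∑' a, finalOverlap U e e' a (j, l) * ENNReal.ofReal (s a.1 * gibbsWeight β ω a.2) =
      ENNReal.ofReal (s' j) := by
  have hpos := isPositive_finalState U h hρ.1
  have htr : posTrace (finalState β ω ρ U) ≠ ⊤ :=
    posTrace_finalState U h hρ ▸ ENNReal.one_ne_top
  have h1 := ofReal_inner_traceMachine hpos htr (e' j)
  rw [show traceMachine (finalState β ω ρ U) = finalTarget β ω ρ U from rfl, he',
    inner_smul_right, inner_self_eq_norm_sq_to_K, e'.orthonormal.1] at h1
  simp_rw [ofReal_inner_finalState U h hρ.1 hs he, mul_comm (ENNReal.ofReal (s _ * _))] at h1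
  simpa [finalOverlap] using h1.symm

theorem finalPopulation_nonneg (hρ : IsState ρ) (n : ι) : 0 ≤ finalPopulation U β ω ρ n :=
  (isPositive_traceTarget (isPositive_finalState U h hρ.1)).re_inner_nonneg_right _

/-- Tracing out the target gives the same result in any target basis, so `e'` need not diagonalise
anything here. -/
theorem tsum_finalOverlap_machine (hρ : IsState ρ) (hs : ∀ i, 0 ≤ s i)
    (he : ∀ i, ρ (e i) = (s i : ℂ) • e i) (e' : HilbertBasis K' ℂ (Hilb κ)) (l : ι) :
    ∑' j, ∑' a, finalOverlap U e e' a (j, l) * ENNReal.ofReal (s a.1 * gibbsWeight β ω a.2) =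
      ENNReal.ofReal (finalPopulation U β ω ρ l) := by
  have hpos := isPositive_finalState U h hρ.1
  have htr : posTrace (finalState β ω ρ U) ≠ ⊤ :=
    posTrace_finalState U h hρ ▸ ENNReal.one_ne_top
  have h1 := ofReal_inner_traceTarget hpos htr (ket l)
  rw [finalPopulation, finalMachine, h1, ENNReal.tsum_comm]
  simp_rw [ofReal_inner_finalState U h hρ.1 hs he, mul_comm _ (ENNReal.ofReal (s _ * _))]
  rw [ENNReal.tsum_comm (α := κ)]
  refine tsum_congr fun a => ?_
  simp_rw [ENNReal.tsum_mul_left, finalOverlap, ← ketBasis_apply (κ := κ)]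
  rw [tsum_overlap_tmul, tsum_overlap_tmul]

theorem tsum_finalPopulation (hρ : IsState ρ) :
    ∑' n, ENNReal.ofReal (finalPopulation U β ω ρ n) = 1 := by
  obtain ⟨K, e, s, hs, -, -, he, -⟩ := hρ.exists_eigenbasis
  obtain ⟨K', e', s', -, -, hs1', he', -⟩ := (isState_finalTarget U h hρ).exists_eigenbasis
  simp_rw [← tsum_finalOverlap_machine U h hρ hs he e']
  rw [ENNReal.tsum_comm]
  simp_rw [tsum_finalOverlap_target U h hρ hs he he']
  exact hs1'

/-- Entropy balance of the process, relative to weights `v` on the energy levels. -/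
theorem entropy_balance_finalState (hρ : IsState ρ) (hs : ∀ i, 0 ≤ s i)
    (hs1 : ∑' i, ENNReal.ofReal (s i) = 1) (he : ∀ i, ρ (e i) = (s i : ℂ) • e i)
    (hs' : ∀ i, 0 ≤ s' i) (hs1' : ∑' i, ENNReal.ofReal (s' i) = 1)
    (he' : ∀ j, finalTarget β ω ρ U (e' j) = (s' j : ℂ) • e' j)
    {v : ι → ℝ} (hv : ∀ n, 0 ≤ v n) (hv1 : ∑' n, ENNReal.ofReal (v n) = 1)
    (hvq : ∀ l, v l = 0 → finalPopulation U β ω ρ l = 0) :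
    entropy ρ + ∑' n, ENNReal.ofReal (Real.negMulLog (gibbsWeight β ω n)) +
        ∑' a, ∑' b, finalOverlap U e e' a b *
          ENNReal.ofReal ((√(s a.1 * gibbsWeight β ω a.2) - √(s' b.1 * v b.2)) ^ 2) ≤
      entropy (finalTarget β ω ρ U) +
        ∑' l, ENNReal.ofReal (finalPopulation U β ω ρ l) * ENNReal.ofReal (-Real.log (v l)) := by
  rw [entropy_eq hρ.1.isSelfAdjoint e hs (le_one_of_tsum_ofReal hs1) he,
    entropy_eq (isState_finalTarget U h hρ).1.isSelfAdjoint e' hs' (le_one_of_tsum_ofReal hs1') he']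
  exact entropy_balance _ (tsum_finalOverlap_row U) (tsum_finalOverlap_col U) hs hs1
    (fun n => (gibbsWeight_pos h n).le) (tsum_ofReal_gibbsWeight h) hs' hs1' hv hv1
    (tsum_finalOverlap_target U h hρ hs he he') (tsum_finalOverlap_machine U h hρ hs he e') hvq

theorem energyChange_eq_tsum :
    energyChange β ω ρ U = ∑' n, ω n * (finalPopulation U β ω ρ n - gibbsWeight β ω n) := by
  refine tsum_congr fun n => ?_
  rw [sub_apply, inner_sub_right, gibbsState_inner h, Complex.sub_re, Complex.ofReal_re]
  rfl

omit [Nonempty ι] h in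
theorem hasSum_of_tsum_ofReal {I : Type*} {f : I → ℝ} (hf : ∀ i, 0 ≤ f i)
    (h1 : ∑' i, ENNReal.ofReal (f i) = 1) : HasSum f 1 := by
  have hs : Summable f := by
    have := ENNReal.summable_toReal (h1 ▸ ENNReal.one_ne_top)
    simpa [ENNReal.toReal_ofReal (hf _)] using this
  rw [← ENNReal.ofReal_tsum_of_nonneg hf hs, ENNReal.ofReal_eq_one] at h1
  exact h1 ▸ hs.hasSum

-- Averaging −log pₙ = βωₙ + log Z against q. The second conclusion lets the identity be read back
-- from `ℝ≥0∞` to the reals.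
omit U in
theorem tsum_mul_neg_log_gibbsWeight {q : ι → ℝ} (hq : ∀ n, 0 ≤ q n) (hq1 : HasSum q 1)
    (hE : Summable fun n => ω n * q n) :
    ∑' n, ENNReal.ofReal (q n) * ENNReal.ofReal (-Real.log (gibbsWeight β ω n)) =
      ENNReal.ofReal (β * (∑' n, ω n * q n) + Real.log (partitionFn β ω)) ∧
    0 ≤ β * (∑' n, ω n * q n) + Real.log (partitionFn β ω) := by
  have h1 : HasSum (fun n => q n * -Real.log (gibbsWeight β ω n))
      (β * (∑' n, ω n * q n) + Real.log (partitionFn β ω)) := by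
    have h2 := (hE.hasSum.mul_left β).add (hq1.mul_left (Real.log (partitionFn β ω)))
    rw [mul_one] at h2
    refine h2.congr_fun fun n => ?_
    rw [log_gibbsWeight h]
    ring
  have hnn : ∀ n, 0 ≤ q n * -Real.log (gibbsWeight β ω n) := fun n =>
    mul_nonneg (hq n) (neg_nonneg.2 (Real.log_nonpos (gibbsWeight_pos h n).le
      (gibbsWeight_le_one h n)))
  refine ⟨?_, h1.nonneg hnn⟩
  rw [← h1.tsum_eq, ENNReal.ofReal_tsum_of_nonneg hnn h1.summable]
  exact tsum_congr fun n => (ENNReal.ofReal_mul (hq n)).symm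

/-- The excess of the dissipated heat over the Landauer bound controls the distance between the
final joint state and the product of the final target state with the Gibbs state. -/
theorem tsum_finalOverlap_le_excess (hρ : IsState ρ) (hs : ∀ i, 0 ≤ s i)
    (hs1 : ∑' i, ENNReal.ofReal (s i) = 1) (he : ∀ i, ρ (e i) = (s i : ℂ) • e i)
    (hs' : ∀ i, 0 ≤ s' i) (hs1' : ∑' i, ENNReal.ofReal (s' i) = 1)
    (he' : ∀ j, finalTarget β ω ρ U (e' j) = (s' j : ℂ) • e' j)
    (hS : entropy ρ ≠ ⊤) (hS' : entropy (finalTarget β ω ρ U) ≠ ⊤)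
    (hE : HasFiniteEnergy ω (gibbsState β ω))
    (hE' : HasFiniteEnergy ω (finalMachine β ω ρ U)) :
    ∑' a, ∑' b, finalOverlap U e e' a b *
        ENNReal.ofReal
          ((√(s a.1 * gibbsWeight β ω a.2) - √(s' b.1 * gibbsWeight β ω b.2)) ^ 2) ≤
      ENNReal.ofReal (β * energyChange β ω ρ U - entropyDecrease β ω ρ U) := by
  -- With the Gibbs weights as reference, both the entropy of τ and the final cross entropy are β
  -- times a mean energy plus log Z. The log Z cancels, and the finite energies allow the difference
  -- of means to be written as one sum.
  have hb := entropy_balance_finalState U h hρ hs hs1 he hs' hs1' he'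
    (fun n => (gibbsWeight_pos h n).le) (tsum_ofReal_gibbsWeight h)
    (fun l hl => absurd hl (gibbsWeight_pos h l).ne')
  have hEp : Summable fun n => ω n * gibbsWeight β ω n := by
    unfold HasFiniteEnergy at hE
    simpa only [gibbsState_inner h, Complex.ofReal_re] using hE
  have hEq : Summable fun n => ω n * finalPopulation U β ω ρ n := hE'
  obtain ⟨hp, hp0⟩ := tsum_mul_neg_log_gibbsWeight h (fun n => (gibbsWeight_pos h n).le)
    (hasSum_gibbsWeight h) hEp
  obtain ⟨hq, hq0⟩ := tsum_mul_neg_log_gibbsWeight h (finalPopulation_nonneg U h hρ)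
    (hasSum_of_tsum_ofReal (finalPopulation_nonneg U h hρ) (tsum_finalPopulation U h hρ)) hEq
  have hp' : ∑' n, ENNReal.ofReal (Real.negMulLog (gibbsWeight β ω n)) =
      ENNReal.ofReal (β * (∑' n, ω n * gibbsWeight β ω n) + Real.log (partitionFn β ω)) := by
    rw [← hp]
    refine tsum_congr fun n => ?_
    rw [← ENNReal.ofReal_mul (gibbsWeight_pos h n).le, Real.negMulLog, neg_mul, mul_neg]
  rw [hp', hq, ← ENNReal.ofReal_toReal hS, ← ENNReal.ofReal_toReal hS',
    ← ENNReal.ofReal_add ENNReal.toReal_nonneg hp0,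
    ← ENNReal.ofReal_add ENNReal.toReal_nonneg hq0] at hb
  rw [energyChange_eq_tsum U h, entropyDecrease]
  simp_rw [mul_sub (ω _)]
  rw [hEq.tsum_sub hEp]
  refine (ENNReal.le_sub_of_add_le_left ENNReal.ofReal_ne_top hb).trans ?_
  rw [← ENNReal.ofReal_sub _ (add_nonneg ENNReal.toReal_nonneg hp0)]
  refine ENNReal.ofReal_le_ofReal (le_of_eq ?_)
  ring

end Balance

/-! ### Lower semicontinuity of the entropy via a truncated −x log x -/

section Truncation

/-- The function `x ↦ -x log x`, with its slope at `0` cut off at `c`. -/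
noncomputable def truncNegMulLog (c x : ℝ) : ℝ := min (x * c) (Real.negMulLog x)

variable {c x r w : ℝ}

theorem truncNegMulLog_nonneg (hc : 0 ≤ c) (hx : 0 ≤ x) (hx1 : x ≤ 1) :
    0 ≤ truncNegMulLog c x :=
  le_min (mul_nonneg hx hc) (Real.negMulLog_nonneg hx hx1)

/-- Both bounds needed here follow from log y ≤ y − 1 at y = e⁻ᶜ/x, which gives −x log x − cx ≤ e⁻ᶜ
− x. The loss is constant per term, so truncation is only undone on finite sets. -/
theorem negMulLog_le_truncNegMulLog_add (hx : 0 ≤ x) :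
    Real.negMulLog x ≤ truncNegMulLog c x + Real.exp (-c) := by
  rw [truncNegMulLog, ← min_add_add_right, le_min_iff]
  refine ⟨?_, by linarith [Real.exp_pos (-c)]⟩
  rcases hx.eq_or_lt with rfl | hx0
  · simpa using (Real.exp_pos (-c)).le
  have h := Real.log_le_sub_one_of_pos (div_pos (Real.exp_pos (-c)) hx0)
  rw [Real.log_div (Real.exp_pos _).ne' hx0.ne', Real.log_exp] at h
  have h2 := mul_le_mul_of_nonneg_left h hx
  have h3 : x * (Real.exp (-c) / x - 1) = Real.exp (-c) - x := by field_simp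
  rw [Real.negMulLog]
  nlinarith

theorem negMulLog_le_tangent (hr : 0 ≤ r) (hw : 0 < w) :
    Real.negMulLog r ≤ Real.negMulLog w + (-Real.log w - 1) * (r - w) := by
  rcases hr.eq_or_lt with rfl | hr0
  · rw [Real.negMulLog]; simp [Real.negMulLog]; nlinarith
  have h := Real.log_le_sub_one_of_pos (div_pos hw hr0)
  rw [Real.log_div hw.ne' hr0.ne'] at h
  have h2 := mul_le_mul_of_nonneg_left h hr
  have h3 : r * (w / r - 1) = w - r := by field_simp
  rw [Real.negMulLog, Real.negMulLog]
  nlinarith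

/-- A Lipschitz bound by majorants at w: if the linear branch is active at w, its slope is c;
otherwise −log w ≤ c, and the tangent of the concave branch has slope −log w − 1 of modulus at most
c + 1. -/
theorem truncNegMulLog_le_add (hc : 0 ≤ c) (hr : 0 ≤ r) (hw : 0 ≤ w) (hw1 : w ≤ 1) :
    truncNegMulLog c r ≤ truncNegMulLog c w + (c + 1) * |r - w| := by
  have habs := le_abs_self (r - w)
  have habs' := neg_abs_le (r - w)
  by_cases h : w * c ≤ Real.negMulLog w
  · rw [truncNegMulLog, truncNegMulLog, min_eq_left h]
    refine (min_le_left _ _).trans ?_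
    nlinarith [mul_le_mul_of_nonneg_left habs hc, abs_nonneg (r - w)]
  · push Not at h
    have hw0 : 0 < w := lt_of_le_of_ne hw (by rintro rfl; simp at h)
    rw [truncNegMulLog, truncNegMulLog, min_eq_right h.le]
    refine (min_le_right _ _).trans ((negMulLog_le_tangent hr hw0).trans ?_)
    have hl : 0 ≤ -Real.log w := neg_nonneg.2 (Real.log_nonpos hw hw1)
    have hl2 : -Real.log w ≤ c := by
      rw [Real.negMulLog, neg_mul, ← mul_neg] at h
      exact (lt_of_mul_lt_mul_left h hw).le
    have : (-Real.log w - 1) * (r - w) ≤ (c + 1) * |r - w| := by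
      refine (le_abs_self _).trans ?_
      rw [abs_mul]
      refine mul_le_mul_of_nonneg_right (abs_le.2 ⟨by linarith, by linarith⟩) (abs_nonneg _)
    linarith

/-- Factor |r − w| = |√r − √w|(√r + √w) and apply Young's inequality with parameter t. Summed over
probability weights, the last term is only 2t. -/
theorem abs_sub_le_sq_sqrt_sub {t : ℝ} (ht : 0 < t) (hr : 0 ≤ r) (hw : 0 ≤ w) :
    |r - w| ≤ (2 * t)⁻¹ * (√r - √w) ^ 2 + t * (r + w) := by
  have h1 : |r - w| = |√r - √w| * (√r + √w) := by
    rw [← abs_of_nonneg (add_nonneg (Real.sqrt_nonneg r) (Real.sqrt_nonneg w)), ← abs_mul]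
    congr 1
    ring_nf
    rw [Real.sq_sqrt hr, Real.sq_sqrt hw]
  have h2 : r + w = √r ^ 2 + √w ^ 2 := by rw [Real.sq_sqrt hr, Real.sq_sqrt hw]
  rw [h1, h2, ← sq_abs (√r - √w)]
  generalize |√r - √w| = d
  have h3 : (2 * t)⁻¹ * d ^ 2 + t * (√r ^ 2 + √w ^ 2) - d * (√r + √w) =
      (2 * t)⁻¹ * (d - t * (√r + √w)) ^ 2 + t / 2 * (√r - √w) ^ 2 := by
    field_simp
    ring
  have h4 : 0 ≤ (2 * t)⁻¹ * (d - t * (√r + √w)) ^ 2 + t / 2 * (√r - √w) ^ 2 := by positivity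
  linarith

/-- Average the Lipschitz estimate, with the difference bounded by Hellinger terms, against D. Unit
row sums recover the left side, and unit column sums bound the terms in w. -/
theorem sum_truncNegMulLog_le {A B : Type*} (D : A → B → ℝ≥0∞) (hD₁ : ∀ a, ∑' b, D a b = 1)
    (hD₂ : ∀ b, ∑' a, D a b = 1) {r : A → ℝ} {w : B → ℝ} (hr : ∀ a, 0 ≤ r a)
    (hrs : ∑' a, ENNReal.ofReal (r a) = 1) (hw : ∀ b, 0 ≤ w b)
    (hws : ∑' b, ENNReal.ofReal (w b) = 1) {t : ℝ} (hc : 0 ≤ c) (ht : 0 < t) (S : Finset A) :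
    ∑ a ∈ S, ENNReal.ofReal (truncNegMulLog c (r a)) ≤
      ∑' b, ENNReal.ofReal (truncNegMulLog c (w b)) +
        ENNReal.ofReal ((c + 1) * (2 * t)⁻¹) *
          ∑ a ∈ S, ∑' b, D a b * ENNReal.ofReal ((√(r a) - √(w b)) ^ 2) +
        ENNReal.ofReal ((c + 1) * t) * 2 := by
  have hw1 := le_one_of_tsum_ofReal hws
  have key : ∀ a b, ENNReal.ofReal (truncNegMulLog c (r a)) ≤
      ENNReal.ofReal (truncNegMulLog c (w b)) + ENNReal.ofReal ((c + 1) * (2 * t)⁻¹) *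
        ENNReal.ofReal ((√(r a) - √(w b)) ^ 2) +
        ENNReal.ofReal ((c + 1) * t) * (ENNReal.ofReal (r a) + ENNReal.ofReal (w b)) := by
    intro a b
    have h1 := truncNegMulLog_nonneg hc (hw b) (hw1 b)
    rw [← ENNReal.ofReal_mul (by positivity), ← ENNReal.ofReal_add (hr a) (hw b),
      ← ENNReal.ofReal_mul (by positivity), ← ENNReal.ofReal_add h1 (by positivity),
      ← ENNReal.ofReal_add (by positivity)
        (mul_nonneg (by positivity) (add_nonneg (hr a) (hw b)))]
    refine ENNReal.ofReal_le_ofReal ((truncNegMulLog_le_add hc (hr a) (hw b) (hw1 b)).trans ?_)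
    have := mul_le_mul_of_nonneg_left (abs_sub_le_sq_sqrt_sub ht (hr a) (hw b))
      (by positivity : 0 ≤ c + 1)
    linarith
  set C₁ := ENNReal.ofReal ((c + 1) * (2 * t)⁻¹)
  set C₂ := ENNReal.ofReal ((c + 1) * t)
  calc ∑ a ∈ S, ENNReal.ofReal (truncNegMulLog c (r a))
      = ∑ a ∈ S, ∑' b, D a b * ENNReal.ofReal (truncNegMulLog c (r a)) := by
        simp_rw [ENNReal.tsum_mul_right, hD₁, one_mul]
    _ ≤ ∑ a ∈ S, ∑' b, (D a b * ENNReal.ofReal (truncNegMulLog c (w b)) +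
          C₁ * (D a b * ENNReal.ofReal ((√(r a) - √(w b)) ^ 2)) +
          C₂ * (D a b * ENNReal.ofReal (r a) + D a b * ENNReal.ofReal (w b))) := by
        refine Finset.sum_le_sum fun a _ => ENNReal.tsum_le_tsum fun b => ?_
        refine (mul_le_mul_right (key a b) (D a b)).trans (le_of_eq ?_)
        ring
    _ = ∑ a ∈ S, ∑' b, D a b * ENNReal.ofReal (truncNegMulLog c (w b)) +
          C₁ * ∑ a ∈ S, ∑' b, D a b * ENNReal.ofReal ((√(r a) - √(w b)) ^ 2) +
          C₂ * (∑ a ∈ S, ∑' b, D a b * ENNReal.ofReal (r a) +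
            ∑ a ∈ S, ∑' b, D a b * ENNReal.ofReal (w b)) := by
        simp_rw [ENNReal.tsum_add, ENNReal.tsum_mul_left, Finset.sum_add_distrib, Finset.mul_sum,
          ENNReal.tsum_add, mul_add, Finset.sum_add_distrib, Finset.mul_sum]
    _ ≤ _ := by
        refine add_le_add (add_le_add ?_ le_rfl) (mul_le_mul_right ?_ _)
        · exact (ENNReal.sum_le_tsum S).trans (tsum_tsum_mul_of_col D hD₂ _).le
        · rw [← one_add_one_eq_two]
          refine add_le_add ?_ ?_
          · exact (ENNReal.sum_le_tsum S).trans
              ((tsum_tsum_mul_left_of_row D hD₁ _).trans hrs).le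
          · exact (ENNReal.sum_le_tsum S).trans ((tsum_tsum_mul_of_col D hD₂ _).trans hws).le

theorem negMulLog_le_one (hx : 0 ≤ x) : Real.negMulLog x ≤ 1 := by
  have := negMulLog_le_truncNegMulLog_add (c := 0) hx
  rw [truncNegMulLog, mul_zero, neg_zero, Real.exp_zero] at this
  linarith [min_le_left 0 (Real.negMulLog x)]

/-- On F the product rule η(st) = tη(s) + sη(t) is used. Off F the ancilla may have infinite
entropy, and the linear branch charges only c times the tail mass. -/
theorem tsum_truncNegMulLog_prod_le {K ι : Type*} {s : K → ℝ} {t : ι → ℝ} (hs : ∀ i, 0 ≤ s i)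
    (hs1 : ∑' i, ENNReal.ofReal (s i) = 1) (ht : ∀ n, 0 ≤ t n)
    (ht1 : ∑' n, ENNReal.ofReal (t n) = 1) (hc : 0 ≤ c) (F : Finset ι) {ε : ℝ}
    (hF : 1 - ε ≤ ∑ n ∈ F, t n) :
    ∑' z : K × ι, ENNReal.ofReal (truncNegMulLog c (s z.1 * t z.2)) ≤
      ∑' i, ENNReal.ofReal (Real.negMulLog (s i)) +
        ENNReal.ofReal (∑ n ∈ F, Real.negMulLog (t n)) + ENNReal.ofReal (c * ε) := by
  classical
  have hs' := le_one_of_tsum_ofReal hs1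
  have ht' := le_one_of_tsum_ofReal ht1
  have hηs := fun i => Real.negMulLog_nonneg (hs i) (hs' i)
  have hηt := fun n => Real.negMulLog_nonneg (ht n) (ht' n)
  have ht2 := hasSum_of_tsum_ofReal ht ht1
  have hFt : HasSum (fun n => if n ∈ F then 0 else t n) (1 - ∑ n ∈ F, t n) := by
    have h1 := ht2.sub (hasSum_sum_of_ne_finset_zero (s := F)
      (f := fun n => if n ∈ F then t n else 0) (fun b hb => by simp [hb]))
    rw [Finset.sum_ite_mem, Finset.inter_self] at h1
    refine h1.congr_fun fun n => ?_
    split_ifs <;> simp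
  have htail : ∑' n, ENNReal.ofReal (if n ∈ F then 0 else t n) ≤ ENNReal.ofReal ε := by
    rw [← ENNReal.ofReal_tsum_of_nonneg _ hFt.summable, hFt.tsum_eq]
    · exact ENNReal.ofReal_le_ofReal (by linarith)
    · intro n
      split_ifs
      exacts [le_rfl, ht n]
  have key : ∀ z : K × ι, ENNReal.ofReal (truncNegMulLog c (s z.1 * t z.2)) ≤
      ENNReal.ofReal (Real.negMulLog (s z.1)) * ENNReal.ofReal (t z.2) +
      ENNReal.ofReal (s z.1) * ENNReal.ofReal (if z.2 ∈ F then Real.negMulLog (t z.2) else 0) +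
      ENNReal.ofReal c * (ENNReal.ofReal (s z.1) *
        ENNReal.ofReal (if z.2 ∈ F then 0 else t z.2)) := by
    rintro ⟨i, n⟩
    dsimp only
    split_ifs with hn
    · refine (ENNReal.ofReal_le_ofReal (min_le_right _ _)).trans ?_
      rw [Real.negMulLog_mul, ENNReal.ofReal_zero, mul_zero, mul_zero, add_zero,
        ENNReal.ofReal_add (mul_nonneg (ht _) (hηs _)) (mul_nonneg (hs _) (hηt _)),
        mul_comm (t n), ENNReal.ofReal_mul (hηs _), ENNReal.ofReal_mul (hs _)]
    · refine (ENNReal.ofReal_le_ofReal (min_le_left _ _)).trans ?_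
      rw [ENNReal.ofReal_mul (mul_nonneg (hs _) (ht _)), ENNReal.ofReal_mul (hs _),
        mul_comm (ENNReal.ofReal c)]
      exact le_add_self
  refine (ENNReal.tsum_le_tsum key).trans ?_
  rw [ENNReal.tsum_add, ENNReal.tsum_add, ENNReal.tsum_mul_left, ENNReal.tsum_prod',
    ENNReal.tsum_prod', ENNReal.tsum_prod']
  simp_rw [ENNReal.tsum_mul_left, ENNReal.tsum_mul_right, ht1, hs1, mul_one, one_mul]
  refine add_le_add (add_le_add le_rfl ?_) ?_
  · rw [ENNReal.ofReal_sum_of_nonneg fun n _ => hηt n, tsum_eq_sum (s := F)]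
    · exact (Finset.sum_congr rfl fun n hn => by rw [if_pos hn]).le
    · intro n hn
      rw [if_neg hn, ENNReal.ofReal_zero]
  · rw [ENNReal.ofReal_mul hc]
    exact mul_le_mul_right htail _

theorem le_toReal_add_of_ofReal_le {a T d e f g : ℝ} {h : ℝ≥0∞} (hh : h ≠ ⊤) (hT : 0 ≤ T)
    (hd : 0 ≤ d) (he : 0 ≤ e) (hf : 0 ≤ f) (hg : 0 ≤ g)
    (H : ENNReal.ofReal a ≤ h + ENNReal.ofReal T + ENNReal.ofReal d +
      ENNReal.ofReal e * ENNReal.ofReal f + ENNReal.ofReal g * 2) :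
    a ≤ h.toReal + T + d + e * f + g * 2 := by
  have h0 : 0 ≤ h.toReal := ENNReal.toReal_nonneg
  rw [← ENNReal.ofReal_le_ofReal_iff (by positivity), ENNReal.ofReal_add (by positivity)
    (by positivity), ENNReal.ofReal_add (by positivity) (by positivity),
    ENNReal.ofReal_add (by positivity) hd, ENNReal.ofReal_add h0 hT, ENNReal.ofReal_toReal hh,
    ENNReal.ofReal_mul he, ENNReal.ofReal_mul hg, ENNReal.ofReal_ofNat]
  exact H

/-- The two preceding estimates combined on the finite box I × F. The ancilla entropy on F appears
on both sides, so it nearly cancels when I carries almost all the mass. -/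
theorem sum_negMulLog_mul_add_le {K K' ι : Type*} {s : K → ℝ} {s' : K' → ℝ} {t : ι → ℝ}
    {D : K × ι → K' × ι → ℝ≥0∞} (hs : ∀ i, 0 ≤ s i) (hs1 : ∑' i, ENNReal.ofReal (s i) = 1)
    (hD₁ : ∀ a, ∑' b, D a b = 1) (hD₂ : ∀ b, ∑' a, D a b = 1)
    (hs' : ∀ j, 0 ≤ s' j) (hs1' : ∑' j, ENNReal.ofReal (s' j) = 1)
    (ht : ∀ n, 0 ≤ t n) (ht1 : ∑' n, ENNReal.ofReal (t n) = 1)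
    (hS' : ∑' j, ENNReal.ofReal (Real.negMulLog (s' j)) ≠ ⊤) {I : Finset K} {F : Finset ι}
    {ε t₀ : ℝ} (hc : 0 ≤ c) (ht0 : 0 < t₀) (hε : 0 ≤ ε) (hF : 1 - ε ≤ ∑ n ∈ F, t n)
    (hX : ∑ a ∈ I ×ˢ F, ∑' b, D a b *
      ENNReal.ofReal ((√(s a.1 * t a.2) - √(s' b.1 * t b.2)) ^ 2) ≤ ENNReal.ofReal ε) :
    (∑ n ∈ F, t n) * (∑ i ∈ I, Real.negMulLog (s i)) +
        (∑ i ∈ I, s i) * ∑ n ∈ F, Real.negMulLog (t n) ≤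
      (∑' j, ENNReal.ofReal (Real.negMulLog (s' j))).toReal + ∑ n ∈ F, Real.negMulLog (t n) +
        c * ε + (c + 1) * (2 * t₀)⁻¹ * ε + (c + 1) * t₀ * 2 +
        (I.card * F.card : ℝ) * Real.exp (-c) := by
  have hs_le := le_one_of_tsum_ofReal hs1
  have ht_le := le_one_of_tsum_ofReal ht1
  have hr0 : ∀ a : K × ι, 0 ≤ s a.1 * t a.2 := fun a => mul_nonneg (hs _) (ht _)
  have hr1 : ∀ a : K × ι, s a.1 * t a.2 ≤ 1 := fun a => mul_le_one₀ (hs_le _) (ht _) (ht_le _)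
  have h1 := sum_truncNegMulLog_le D hD₁ hD₂ (r := fun a => s a.1 * t a.2)
    (w := fun b => s' b.1 * t b.2) hr0 (tsum_prod_weights hs hs1 ht1)
    (fun b => mul_nonneg (hs' _) (ht _)) (tsum_prod_weights hs' hs1' ht1) hc ht0 (I ×ˢ F)
  have h2 := tsum_truncNegMulLog_prod_le hs' hs1' ht ht1 hc F hF
  have h3 := le_toReal_add_of_ofReal_le (a := ∑ a ∈ I ×ˢ F, truncNegMulLog c (s a.1 * t a.2))
    (e := (c + 1) * (2 * t₀)⁻¹) (g := (c + 1) * t₀) hS'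
    (Finset.sum_nonneg fun n _ => Real.negMulLog_nonneg (ht n) (ht_le n)) (mul_nonneg hc hε)
    (by positivity) hε (by positivity) (by
      rw [ENNReal.ofReal_sum_of_nonneg fun a _ => truncNegMulLog_nonneg hc (hr0 a) (hr1 a)]
      exact h1.trans (add_le_add (add_le_add h2 (mul_le_mul_right hX _)) le_rfl))
  have h4 : ∑ a ∈ I ×ˢ F, Real.negMulLog (s a.1 * t a.2) ≤
      ∑ a ∈ I ×ˢ F, (truncNegMulLog c (s a.1 * t a.2) + Real.exp (-c)) :=
    Finset.sum_le_sum fun a _ => negMulLog_le_truncNegMulLog_add (hr0 a)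
  rw [Finset.sum_add_distrib, Finset.sum_const, Finset.card_product, nsmul_eq_mul,
    Nat.cast_mul] at h4
  have h5 : ∑ a ∈ I ×ˢ F, Real.negMulLog (s a.1 * t a.2) =
      (∑ n ∈ F, t n) * (∑ i ∈ I, Real.negMulLog (s i)) +
        (∑ i ∈ I, s i) * ∑ n ∈ F, Real.negMulLog (t n) := by
    rw [Finset.sum_product, mul_comm (∑ n ∈ F, t n), Finset.sum_mul_sum, Finset.sum_mul_sum,
      ← Finset.sum_add_distrib]
    refine Finset.sum_congr rfl fun i _ => ?_
    rw [← Finset.sum_add_distrib]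
    refine Finset.sum_congr rfl fun n _ => ?_
    rw [Real.negMulLog_mul]
    ring
  rw [← h5]
  linarith

/-- Lower semicontinuity of the entropy, in the presence of an ancilla which is concentrated on at
most `m` levels. -/
theorem exists_entropy_lt_add {K : Type u} {s : K → ℝ} (hs : ∀ i, 0 ≤ s i)
    (hs1 : ∑' i, ENNReal.ofReal (s i) = 1)
    (hS : ∑' i, ENNReal.ofReal (Real.negMulLog (s i)) ≠ ⊤) {δ : ℝ} (hδ : 0 < δ) (m : ℕ) :
    ∃ (I : Finset K) (ε : ℝ), 0 < ε ∧ ∀ (K' : Type u) (ι : Type v) (s' : K' → ℝ) (t : ι → ℝ)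
      (D : K × ι → K' × ι → ℝ≥0∞) (F : Finset ι),
      (∀ a, ∑' b, D a b = 1) → (∀ b, ∑' a, D a b = 1) →
      (∀ j, 0 ≤ s' j) → ∑' j, ENNReal.ofReal (s' j) = 1 →
      (∀ n, 0 ≤ t n) → ∑' n, ENNReal.ofReal (t n) = 1 →
      F.card ≤ m → 1 - ε ≤ ∑ n ∈ F, t n →
      ∑ a ∈ I ×ˢ F, ∑' b, D a b *
        ENNReal.ofReal ((√(s a.1 * t a.2) - √(s' b.1 * t b.2)) ^ 2) ≤ ENNReal.ofReal ε →
      ∑' i, ENNReal.ofReal (Real.negMulLog (s i)) <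
        ∑' j, ENNReal.ofReal (Real.negMulLog (s' j)) + ENNReal.ofReal δ := by
  have hs' := le_one_of_tsum_ofReal hs1
  have hηs := fun i => Real.negMulLog_nonneg (hs i) (hs' i)
  have hsum := hasSum_of_tsum_ofReal hs hs1
  have hηsum : Summable fun i => Real.negMulLog (s i) := by
    have := ENNReal.summable_toReal hS
    simpa [ENNReal.toReal_ofReal (hηs _)] using this
  set H := ∑' i, Real.negMulLog (s i) with hH
  have hHE : ∑' i, ENNReal.ofReal (Real.negMulLog (s i)) = ENNReal.ofReal H :=
    (ENNReal.ofReal_tsum_of_nonneg hηs hηsum).symm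
  have hH0 : 0 ≤ H := tsum_nonneg hηs
  have hev1 : ∀ᶠ I : Finset K in atTop, H - δ / 8 < ∑ i ∈ I, Real.negMulLog (s i) :=
    hηsum.hasSum.eventually_const_lt (by linarith)
  have hev2 : ∀ᶠ I : Finset K in atTop, 1 - δ / (8 * (m + 1)) < ∑ i ∈ I, s i :=
    hsum.eventually_const_lt (by linarith [show 0 < δ / (8 * ((m : ℝ) + 1)) by positivity])
  -- The missing mass of I is scaled by m + 1 because the ancilla entropy on F can be as large as m.
  obtain ⟨I, hI1, hI2⟩ := (hev1.and hev2).exists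
  -- Error budget, five shares of δ/8: the entropy missed by I, its missing mass times the ancilla
  -- entropy, the truncation loss A e⁻ᶜ (fixes c), the Young term 2(c + 1)t₀ (fixes t₀), and εE,
  -- where E collects all coefficients of ε (fixes ε).
  set A : ℝ := I.card * m with hA
  have hA0 : 0 ≤ A := by positivity
  set c : ℝ := 8 * A / δ with hcdef
  have hc : 0 ≤ c := by positivity
  have hcA : A * Real.exp (-c) ≤ δ / 8 := by
    have h1 : Real.exp (-c) ≤ (1 + c)⁻¹ := by
      rw [Real.exp_neg]
      exact inv_anti₀ (by positivity) (by linarith [Real.add_one_le_exp c])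
    refine (mul_le_mul_of_nonneg_left h1 hA0).trans ?_
    rw [← div_eq_mul_inv, div_le_iff₀ (by positivity)]
    have : δ / 8 * c = A := by rw [hcdef]; field_simp
    nlinarith
  set t₀ : ℝ := δ / (16 * (c + 1)) with ht0def
  have ht0 : 0 < t₀ := by positivity
  have hct : (c + 1) * t₀ * 2 = δ / 8 := by rw [ht0def]; field_simp; norm_num
  set E : ℝ := H + c + (c + 1) * (2 * t₀)⁻¹ with hE
  have hE0 : 0 ≤ E := by positivity
  refine ⟨I, δ / (8 * (E + 1)), by positivity, ?_⟩
  set ε := δ / (8 * (E + 1)) with hε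
  have hε0 : 0 < ε := by positivity
  have hεE : ε * E ≤ δ / 8 := by
    have : ε * (E + 1) = δ / 8 := by rw [hε]; field_simp
    nlinarith
  intro K' ι s₂ t D F hD₁ hD₂ hs2 hs21 ht ht1 hFm hFt hX
  have ht' := le_one_of_tsum_ofReal ht1
  have hηt := fun n => Real.negMulLog_nonneg (ht n) (ht' n)
  set H' := ∑' j, ENNReal.ofReal (Real.negMulLog (s₂ j)) with hH'
  by_cases hH'top : H' = ⊤
  · rw [hH'top, top_add]; exact hS.lt_top
  have h3 := sum_negMulLog_mul_add_le hs hs1 hD₁ hD₂ hs2 hs21 ht ht1 hH'top hc ht0 hε0.le hFt hX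
  have h4 : (I.card * F.card : ℝ) * Real.exp (-c) ≤ A * Real.exp (-c) := by
    rw [hA]
    have : (F.card : ℝ) ≤ m := by exact_mod_cast hFm
    gcongr
  set T := ∑ n ∈ F, Real.negMulLog (t n) with hT
  have hT0 : 0 ≤ T := Finset.sum_nonneg fun n _ => hηt n
  have hTm : T ≤ m := by
    have := Finset.sum_le_sum fun n (_ : n ∈ F) => negMulLog_le_one (ht n)
    simp only [Finset.sum_const, nsmul_eq_mul, mul_one] at this
    exact this.trans (by exact_mod_cast hFm)
  set HI := ∑ i ∈ I, Real.negMulLog (s i) with hHI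
  have hHI0 : 0 ≤ HI := Finset.sum_nonneg fun i _ => hηs i
  have hHIH : HI ≤ H := hηsum.sum_le_tsum I fun i _ => hηs i
  have h6 : (1 - ε) * HI ≤ (∑ n ∈ F, t n) * HI := mul_le_mul_of_nonneg_right hFt hHI0
  have h7 : (1 - ∑ i ∈ I, s i) * T ≤ δ / 8 := by
    have h8 : δ / (8 * ((m : ℝ) + 1)) * (m + 1) = δ / 8 := by field_simp
    have h9 : (1 - ∑ i ∈ I, s i) * T ≤ δ / (8 * ((m : ℝ) + 1)) * T :=
      mul_le_mul_of_nonneg_right (by linarith) hT0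
    have h10 : δ / (8 * ((m : ℝ) + 1)) * T ≤ δ / (8 * ((m : ℝ) + 1)) * (m + 1) :=
      mul_le_mul_of_nonneg_left (by linarith) (by positivity)
    linarith
  have h8 : ε * HI ≤ ε * H := mul_le_mul_of_nonneg_left hHIH hε0.le
  have h9 : ε * E = ε * H + c * ε + (c + 1) * (2 * t₀)⁻¹ * ε := by rw [hE]; ring
  have hfin : H < H'.toReal + δ := by nlinarith
  rw [hHE, ← ENNReal.ofReal_toReal hH'top, ← ENNReal.ofReal_add ENNReal.toReal_nonneg hδ.le]
  exact (ENNReal.ofReal_lt_ofReal_iff (by linarith)).2 hfin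

end Truncation

/-! ### Bounded dimension bounds the total displacement -/

section Displacement

/-- The sum is at most the trace of the projection: expand in an orthonormal basis of A and apply
Bessel to each basis vector. -/
theorem tsum_norm_starProjection_le {H : Type*} [NormedAddCommGroup H] [InnerProductSpace ℂ H]
    {I : Type*} {z : I → H} (hz : Orthonormal ℂ z) (A : Submodule ℂ H) [FiniteDimensional ℂ A] :
    ∑' n, ENNReal.ofReal (‖A.starProjection (z n)‖ ^ 2) ≤ Module.finrank ℂ A := by
  let b := stdOrthonormalBasis ℂ A
  have h1 : ∀ n, ENNReal.ofReal (‖A.starProjection (z n)‖ ^ 2) =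
      ∑ k, ENNReal.ofReal (‖⟪z n, (b k : H)⟫_ℂ‖ ^ 2) := by
    intro n
    rw [← ENNReal.ofReal_sum_of_nonneg fun _ _ => by positivity]
    congr 1
    rw [Submodule.starProjection_apply, Submodule.norm_coe, ← b.sum_sq_norm_inner_left]
    refine Finset.sum_congr rfl fun k _ => ?_
    rw [Submodule.coe_inner, ← Submodule.starProjection_apply,
      Submodule.inner_starProjection_left_eq_right,
      Submodule.starProjection_eq_self_iff.2 (b k).2]
  simp_rw [h1]
  rw [Summable.tsum_finsetSum fun _ _ => ENNReal.summable]
  have h2 : ∀ k, ∑' n, ENNReal.ofReal (‖⟪z n, (b k : H)⟫_ℂ‖ ^ 2) ≤ 1 := by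
    intro k
    rw [ENNReal.tsum_eq_iSup_sum]
    refine iSup_le fun s => ?_
    rw [← ENNReal.ofReal_sum_of_nonneg fun _ _ => by positivity]
    refine ENNReal.ofReal_le_one.2 ((hz.sum_inner_products_le (x := (b k : H))).trans ?_)
    have : ‖(b k : H)‖ = 1 := b.orthonormal.1 k
    rw [this, one_pow]
  refine (Finset.sum_le_sum fun k _ => h2 k).trans ?_
  simp

variable {κ : Type u} {ι : Type v}

theorem orthonormal_ket : Orthonormal ℂ (ket : ι → Hilb ι) := by
  have h : (ket : ι → Hilb ι) = ketBasis ι := funext fun n => (ketBasis_apply n).symm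
  rw [h]
  exact (ketBasis ι).orthonormal

theorem orthonormal_tmul_ket {y : Hilb κ} (hy : ‖y‖ = 1) :
    Orthonormal ℂ fun n : ι => tmul y (ket n) := by
  classical
  rw [orthonormal_iff_ite]
  intro n m
  rw [inner_tmul, inner_ket_ket, inner_self_eq_norm_sq_to_K, hy]
  simp

theorem norm_unitary_sub_le {H : Type*} [NormedAddCommGroup H] [InnerProductSpace ℂ H]
    [CompleteSpace H] (U : unitary (H →L[ℂ] H)) {x y : H}
    (hy : (U : H →L[ℂ] H) y = y) : ‖(U : H →L[ℂ] H) (x + y) - (x + y)‖ ^ 2 ≤ 4 * ‖x‖ ^ 2 := by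
  have h : ‖(U : H →L[ℂ] H) (x + y) - (x + y)‖ ≤ 2 * ‖x‖ := by
    rw [map_add, hy, add_sub_add_right_eq_sub]
    refine (norm_sub_le _ _).trans ?_
    rw [norm_unitary_apply]
    linarith
  calc _ ≤ (2 * ‖x‖) ^ 2 := by gcongr
    _ = _ := by ring

/-- The total squared displacement of the vectors `y ⊗ |n⟩` under `U` is at most `C`. -/
def DisplacementLE (U : unitary (Hilb (κ × ι) →L[ℂ] Hilb (κ × ι))) (C : ℝ) : Prop :=
  ∀ y : Hilb κ, ‖y‖ = 1 → ∑' n, ENNReal.ofReal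
    (‖(U : Hilb (κ × ι) →L[ℂ] Hilb (κ × ι)) (tmul y (ket n)) - tmul y (ket n)‖ ^ 2) ≤
      ENNReal.ofReal C

theorem exists_finiteDimensional_of_lt {H : Type*} [AddCommGroup H] [Module ℂ H] {d : ℕ}
    {p : Submodule ℂ H → Prop}
    (h : ⨅ (A : Submodule ℂ H) (_ : p A), Cardinal.toENat (Module.rank ℂ A) < d) :
    ∃ A, p A ∧ FiniteDimensional ℂ A ∧ Module.finrank ℂ A ≤ d := by
  obtain ⟨A, hA⟩ := iInf_lt_iff.1 h
  obtain ⟨hp, hA⟩ := iInf_lt_iff.1 hA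
  rw [Cardinal.toENat_lt_natCast] at hA
  have hfin : FiniteDimensional ℂ A :=
    Module.rank_lt_aleph0_iff.1 (hA.trans (Cardinal.natCast_lt_aleph0))
  refine ⟨A, hp, hfin, ?_⟩
  rw [← Module.finrank_eq_rank] at hA
  exact_mod_cast hA.le

/-- Only the component of y ⊗ |n⟩ in A moves, by at most twice its norm; the squared components sum
to at most dim A. -/
theorem displacementLE_of_effectiveDim {U : unitary (Hilb (κ × ι) →L[ℂ] Hilb (κ × ι))} {d : ℕ}
    (h : effectiveDim U < d) : DisplacementLE U (4 * d) := by
  obtain ⟨A, hA, hfin, hd⟩ := exists_finiteDimensional_of_lt h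
  intro y hy
  have h1 := tsum_norm_starProjection_le (orthonormal_tmul_ket (ι := ι) hy) A
  calc _ ≤ ∑' n : ι, ENNReal.ofReal 4 *
        ENNReal.ofReal (‖A.starProjection (tmul y (ket n))‖ ^ 2) := by
        refine ENNReal.tsum_le_tsum fun n => ?_
        rw [← ENNReal.ofReal_mul (by norm_num)]
        refine ENNReal.ofReal_le_ofReal ?_
        have h2 := norm_unitary_sub_le U (x := A.starProjection (tmul y (ket n)))
          (hA.2 _ (A.sub_starProjection_mem_orthogonal (tmul y (ket n))))
        rwa [add_sub_cancel] at h2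
    _ ≤ _ := by
        rw [ENNReal.tsum_mul_left, ENNReal.ofReal_mul (by norm_num), ENNReal.ofReal_natCast]
        exact mul_le_mul_right (h1.trans (by exact_mod_cast hd)) _

theorem tmul_mem_targetTensor_orthogonal (V : Submodule ℂ (Hilb ι)) {v : Hilb ι} (hv : v ∈ Vᗮ)
    (y : Hilb κ) : tmul y v ∈ (targetTensor κ V)ᗮ := by
  rw [targetTensor, Submodule.orthogonal_closure, Submodule.mem_orthogonal]
  intro z hz
  induction hz using Submodule.span_induction with
  | mem z hz =>
    obtain ⟨x, w, hw, rfl⟩ := hz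
    rw [inner_tmul, (Submodule.mem_orthogonal _ _).1 hv w hw, mul_zero]
  | zero => exact inner_zero_left _
  | add a b _ _ ha hb => rw [inner_add_left, ha, hb, add_zero]
  | smul c a _ ha => rw [inner_smul_left, ha, mul_zero]

/-- The joint subspace may be infinite-dimensional, so the projection is applied to |n⟩ alone; the
bound then involves only dim V. -/
theorem displacementLE_of_machineDim {U : unitary (Hilb (κ × ι) →L[ℂ] Hilb (κ × ι))} {d : ℕ}
    (h : machineDim U < d) : DisplacementLE U (4 * d) := by
  obtain ⟨V, hV, hfin, hd⟩ := exists_finiteDimensional_of_lt h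
  intro y hy
  have h1 := tsum_norm_starProjection_le (orthonormal_ket (ι := ι)) V
  calc _ ≤ ∑' n : ι, ENNReal.ofReal 4 * ENNReal.ofReal (‖V.starProjection (ket n)‖ ^ 2) := by
        refine ENNReal.tsum_le_tsum fun n => ?_
        rw [← ENNReal.ofReal_mul (by norm_num)]
        refine ENNReal.ofReal_le_ofReal ?_
        have h2 := norm_unitary_sub_le U (x := tmul y (V.starProjection (ket n)))
          (hV.2 _ (tmul_mem_targetTensor_orthogonal V
            (V.sub_starProjection_mem_orthogonal (ket n)) y))
        rwa [tmul_sub_right, add_sub_cancel, norm_tmul, hy, one_mul] at h2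
    _ ≤ _ := by
        rw [ENNReal.tsum_mul_left, ENNReal.ofReal_mul (by norm_num), ENNReal.ofReal_natCast]
        exact mul_le_mul_right (h1.trans (by exact_mod_cast hd)) _

end Displacement

/-! ### Small excess and bounded displacement exclude cooling -/

section Divergence

theorem overlap_le_two_mul_add {H : Type*} [NormedAddCommGroup H] [InnerProductSpace ℂ H]
    (x y f : H) : overlap x f ≤ 2 * overlap y f + 2 * overlap (y - x) f := by
  rw [overlap, overlap, overlap, ← ENNReal.ofReal_ofNat 2, ← ENNReal.ofReal_mul (by norm_num),
    ← ENNReal.ofReal_mul (by norm_num), ← ENNReal.ofReal_add (by positivity) (by positivity)]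
  refine ENNReal.ofReal_le_ofReal ?_
  have h : ⟪x, f⟫_ℂ = ⟪y, f⟫_ℂ - ⟪y - x, f⟫_ℂ := by rw [inner_sub_left]; ring
  have h2 : ‖⟪x, f⟫_ℂ‖ ≤ ‖⟪y, f⟫_ℂ‖ + ‖⟪y - x, f⟫_ℂ‖ := h ▸ norm_sub_le _ _
  nlinarith [norm_nonneg ⟪x, f⟫_ℂ, sq_nonneg (‖⟪y, f⟫_ℂ‖ - ‖⟪y - x, f⟫_ℂ‖)]

variable {κ : Type u} {ι : Type v} {K K' : Type u}
  {e : HilbertBasis K ℂ (Hilb κ)} {s : K → ℝ} {e' : HilbertBasis K' ℂ (Hilb κ)} {s' : K' → ℝ}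

theorem overlap_tmul_ket (x y : Hilb κ) (n : ι) :
    overlap (tmul x (ket n)) (tmul y (ket n)) = overlap x y := by
  rw [overlap, overlap, inner_tmul, inner_self_eq_norm_sq_to_K, norm_ket]
  simp

/-- If `U` hardly moves `eᵢ ⊗ |n⟩`, then the local distance between the target states is controlled
by the joint distance. -/
theorem mul_tsum_overlap_le (U : unitary (Hilb (κ × ι) →L[ℂ] Hilb (κ × ι))) (hs : ∀ i, 0 ≤ s i)
    (hs1 : ∀ i, s i ≤ 1) (hs' : ∀ i, 0 ≤ s' i) (hs1' : ∀ i, s' i ≤ 1) {p : ι → ℝ}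
    (hp : ∀ n, 0 ≤ p n) (i : K) (n : ι) :
    ENNReal.ofReal (p n) * ∑' j, overlap (e i) (e' j) * ENNReal.ofReal ((√(s i) - √(s' j)) ^ 2) ≤
      2 * ∑' b : K' × ι, finalOverlap U e e' (i, n) b *
        ENNReal.ofReal ((√(s i * p n) - √(s' b.1 * p b.2)) ^ 2) +
      2 * (ENNReal.ofReal (p n) * ENNReal.ofReal
        (‖(U : Hilb (κ × ι) →L[ℂ] Hilb (κ × ι)) (tmul (e i) (ket n)) -
          tmul (e i) (ket n)‖ ^ 2)) := by
  obtain ⟨f, hf⟩ := exists_productBasis ι e'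
  set z := tmul (e i) (ket n) with hz
  set Uz := (U : Hilb (κ × ι) →L[ℂ] Hilb (κ × ι)) z with hUz
  have hinj : Function.Injective fun j : K' => (j, n) := fun j k h => (Prod.mk.inj h).1
  have hsq : ∀ j, (√(s i * p n) - √(s' j * p n)) ^ 2 = p n * (√(s i) - √(s' j)) ^ 2 := by
    intro j
    rw [Real.sqrt_mul (hs i), Real.sqrt_mul (hs' j), ← sub_mul, mul_pow, Real.sq_sqrt (hp n),
      mul_comm]
  have hle : ∀ j, (√(s i) - √(s' j)) ^ 2 ≤ 1 := by
    intro j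
    have h1 := Real.sqrt_nonneg (s i)
    have h2 := Real.sqrt_nonneg (s' j)
    have h3 := Real.sqrt_le_one.2 (hs1 i)
    have h4 := Real.sqrt_le_one.2 (hs1' j)
    rw [sq_le_one_iff_abs_le_one, abs_le]
    constructor <;> linarith
  -- Only entries with unchanged level n are kept, where p n factors out of the square. Replacing Uz
  -- by z costs an overlap of Uz − z, whose weight `hle` bounds by 1.
  have key : ∀ j, ENNReal.ofReal (p n) *
      (overlap (e i) (e' j) * ENNReal.ofReal ((√(s i) - √(s' j)) ^ 2)) ≤
      2 * (finalOverlap U e e' (i, n) (j, n) *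
        ENNReal.ofReal ((√(s i * p n) - √(s' j * p n)) ^ 2)) +
      2 * (ENNReal.ofReal (p n) * overlap (Uz - z) (f (j, n))) := by
    intro j
    rw [hsq, ENNReal.ofReal_mul (hp n), finalOverlap, hf, ← hz, ← hUz,
      ← overlap_tmul_ket (e i) (e' j) n, ← hz]
    have h1 := overlap_le_two_mul_add z Uz (tmul (e' j) (ket n))
    have h2 : ENNReal.ofReal ((√(s i) - √(s' j)) ^ 2) ≤ 1 := ENNReal.ofReal_le_one.2 (hle j)
    calc _ ≤ ENNReal.ofReal (p n) * ((2 * overlap Uz (tmul (e' j) (ket n)) +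
          2 * overlap (Uz - z) (tmul (e' j) (ket n))) *
            ENNReal.ofReal ((√(s i) - √(s' j)) ^ 2)) :=
          mul_le_mul_right (mul_le_mul_left h1 _) _
      _ = 2 * (overlap Uz (tmul (e' j) (ket n)) *
            (ENNReal.ofReal (p n) * ENNReal.ofReal ((√(s i) - √(s' j)) ^ 2))) +
          2 * (ENNReal.ofReal (p n) * overlap (Uz - z) (tmul (e' j) (ket n))) *
            ENNReal.ofReal ((√(s i) - √(s' j)) ^ 2) := by ring
      _ ≤ _ := add_le_add le_rfl ((mul_le_mul_right h2 _).trans (mul_one _).le)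
  rw [← ENNReal.tsum_mul_left]
  refine (ENNReal.tsum_le_tsum key).trans ?_
  rw [ENNReal.tsum_add, ENNReal.tsum_mul_left, ENNReal.tsum_mul_left, ENNReal.tsum_mul_left]
  refine add_le_add (mul_le_mul_right ?_ _) (mul_le_mul_right (mul_le_mul_right ?_ _) _)
  · exact ENNReal.tsum_comp_le_tsum_of_injective hinj (fun b : K' × ι =>
      finalOverlap U e e' (i, n) b * ENNReal.ofReal ((√(s i * p n) - √(s' b.1 * p b.2)) ^ 2))
  · exact (ENNReal.tsum_comp_le_tsum_of_injective hinj fun b => overlap (Uz - z) (f b)).trans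
      (tsum_overlap' f _).le

theorem sum_le_of_tsum_le {A : Type*} {f : A → ℝ≥0∞} {c : ℝ≥0∞} (h : ∑' a, f a ≤ c)
    (S : Finset A) : ∑ a ∈ S, f a ≤ c := (ENNReal.sum_le_tsum S).trans h

/-- A level set estimate: outside at most `4 C / θ` levels, the Gibbs weights are small. -/
theorem exists_concentration (U : unitary (Hilb (κ × ι) →L[ℂ] Hilb (κ × ι)))
    (hs : ∀ i, 0 ≤ s i) (hs1 : ∀ i, s i ≤ 1) (hs' : ∀ i, 0 ≤ s' i) (hs1' : ∀ i, s' i ≤ 1)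
    {p : ι → ℝ} (hp : ∀ n, 0 ≤ p n) (hp1 : ∑' n, ENNReal.ofReal (p n) = 1) {C θ ε : ℝ}
    (hU : DisplacementLE U C) (hθ : 0 < θ) (hε : 0 ≤ ε) {m : ℕ}
    (hm : 4 * C / θ ≤ m) (i : K)
    (hi : ENNReal.ofReal θ ≤
      ∑' j, overlap (e i) (e' j) * ENNReal.ofReal ((√(s i) - √(s' j)) ^ 2))
    (hX : ∑' a : K × ι, ∑' b : K' × ι, finalOverlap U e e' a b *
      ENNReal.ofReal ((√(s a.1 * p a.2) - √(s' b.1 * p b.2)) ^ 2) ≤ ENNReal.ofReal ε) :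
    ∃ F : Finset ι, F.card ≤ m ∧ 1 - 4 * ε / θ ≤ ∑ n ∈ F, p n := by
  classical
  have hθ4 : ENNReal.ofReal (θ / 4) ≠ 0 := by
    rw [Ne, ENNReal.ofReal_eq_zero, not_le]; positivity
  -- Markov's inequality: F consists of the levels whose squared displacement is at least θ/4.
  obtain ⟨hfin, hcard⟩ := ENNReal.finset_card_const_le_le_of_tsum_le ENNReal.ofReal_ne_top
    (hU (e i) (e.orthonormal.1 i)) hθ4
  set F := hfin.toFinset with hF
  refine ⟨F, ?_, ?_⟩
  · rw [← ENNReal.ofReal_div_of_pos (by positivity)] at hcard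
    have h1 : C / (θ / 4) ≤ m := by
      refine le_trans (le_of_eq ?_) hm
      field_simp
    have h2 := hcard.trans (ENNReal.ofReal_le_ofReal h1)
    rw [ENNReal.ofReal_natCast] at h2
    exact_mod_cast h2
  -- Off F the displacement term is at most pₙθ/2, half of the lower bound pₙθ, and is cancelled.
  have hn : ∀ n ∉ F, ENNReal.ofReal (p n) * ENNReal.ofReal (θ / 2) ≤
      2 * ∑' b : K' × ι, finalOverlap U e e' (i, n) b *
        ENNReal.ofReal ((√(s i * p n) - √(s' b.1 * p b.2)) ^ 2) := by
    intro n hnF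
    have h1 := mul_tsum_overlap_le U hs hs1 hs' hs1' hp i n (e := e) (e' := e')
    rw [hF, Set.Finite.mem_toFinset, Set.mem_ofPred_eq, not_le] at hnF
    have h2 : 2 * (ENNReal.ofReal (p n) * ENNReal.ofReal
        (‖(U : Hilb (κ × ι) →L[ℂ] Hilb (κ × ι)) (tmul (e i) (ket n)) -
          tmul (e i) (ket n)‖ ^ 2)) ≤ ENNReal.ofReal (p n) * ENNReal.ofReal (θ / 2) := by
      refine (mul_le_mul_right (mul_le_mul_right hnF.le _) _).trans (le_of_eq ?_)
      rw [← ENNReal.ofReal_ofNat 2, ← ENNReal.ofReal_mul (hp n),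
        ← ENNReal.ofReal_mul (by norm_num), ← ENNReal.ofReal_mul (hp n)]
      congr 1
      ring
    have h3 : ENNReal.ofReal (p n) * ENNReal.ofReal (θ / 2) +
        ENNReal.ofReal (p n) * ENNReal.ofReal (θ / 2) ≤ 2 * ∑' b : K' × ι,
          finalOverlap U e e' (i, n) b *
            ENNReal.ofReal ((√(s i * p n) - √(s' b.1 * p b.2)) ^ 2) +
        ENNReal.ofReal (p n) * ENNReal.ofReal (θ / 2) := by
      rw [← mul_add, ← ENNReal.ofReal_add (by positivity) (by positivity), add_halves]
      exact (mul_le_mul_right hi _).trans (h1.trans (add_le_add le_rfl h2))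
    exact (ENNReal.add_le_add_iff_right
      (ENNReal.mul_ne_top ENNReal.ofReal_ne_top ENNReal.ofReal_ne_top)).1 h3
  have hrow : ∑' n : ι, ∑' b : K' × ι, finalOverlap U e e' (i, n) b *
      ENNReal.ofReal ((√(s i * p n) - √(s' b.1 * p b.2)) ^ 2) ≤ ENNReal.ofReal ε := by
    rw [ENNReal.tsum_prod'] at hX
    exact (ENNReal.le_tsum (f := fun i => ∑' n : ι, ∑' b : K' × ι, finalOverlap U e e' (i, n) b *
      ENNReal.ofReal ((√(s i * p n) - √(s' b.1 * p b.2)) ^ 2)) i).trans hX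
  have htail : (∑' n, ENNReal.ofReal (if n ∈ F then 0 else p n)) * ENNReal.ofReal (θ / 2) ≤
      2 * ENNReal.ofReal ε := by
    rw [← ENNReal.tsum_mul_right]
    refine le_trans ?_ (mul_le_mul_right hrow 2)
    rw [← ENNReal.tsum_mul_left]
    refine ENNReal.tsum_le_tsum fun n => ?_
    split_ifs with hnF
    · simp
    · exact hn n hnF
  have hp2 := hasSum_of_tsum_ofReal hp hp1
  have hFt : HasSum (fun n => if n ∈ F then 0 else p n) (1 - ∑ n ∈ F, p n) := by
    have h1 := hp2.sub (hasSum_sum_of_ne_finset_zero (s := F)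
      (f := fun n => if n ∈ F then p n else 0) (fun b hb => by simp [hb]))
    rw [Finset.sum_ite_mem, Finset.inter_self] at h1
    refine h1.congr_fun fun n => ?_
    split_ifs <;> simp
  rw [← ENNReal.ofReal_tsum_of_nonneg _ hFt.summable, hFt.tsum_eq, ← ENNReal.ofReal_ofNat 2,
    ← ENNReal.ofReal_mul' (by positivity), ← ENNReal.ofReal_mul (by norm_num),
    ENNReal.ofReal_le_ofReal_iff (by positivity)] at htail
  · have : 1 - ∑ n ∈ F, p n ≤ 4 * ε / θ := by
      rw [le_div_iff₀ hθ]; linarith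
    linarith
  · intro n
    split_ifs
    exacts [le_rfl, hp n]

/-- A lower bound on the excess over the Landauer bound, for a fixed initial state of the target
and unitaries of bounded displacement. -/
theorem exists_excess_lower_bound {ρ : Hilb κ →L[ℂ] Hilb κ} (hρ : IsState ρ)
    (hS : entropy ρ ≠ ⊤) {δ : ℝ} (hδ : 0 < δ) {C β : ℝ} :
    ∃ ε : ℝ, 0 < ε ∧ ∀ (ι : Type v) [Nonempty ι] (ω : ι → ℝ)
      (U : unitary (Hilb (κ × ι) →L[ℂ] Hilb (κ × ι))),
      (Summable fun n => Real.exp (-β * ω n)) → HasFiniteEnergy ω (gibbsState β ω) →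
      HasFiniteEnergy ω (finalMachine β ω ρ U) → DisplacementLE U C →
      entropy (finalTarget β ω ρ U) + ENNReal.ofReal δ ≤ entropy ρ →
      ε ≤ β * energyChange β ω ρ U - entropyDecrease β ω ρ U := by
  obtain ⟨K, e, s, hs, hs1, hsum, he, hent⟩ := hρ.exists_eigenbasis
  have hHs : ∑' i, ENNReal.ofReal (Real.negMulLog (s i)) ≠ ⊤ := hent ▸ hS
  obtain ⟨I₁, ε₁, hε₁, hL₁⟩ := exists_entropy_lt_add.{u, v} hs hsum hHs hδ 1
  -- The tolerance ε₁ is shared among the rows in I₁; the + 1 keeps the quotient positive if I₁ is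
  -- empty. Since m depends only on C and θ, it is fixed before the machine is chosen.
  set θ : ℝ := ε₁ / (I₁.card + 1) with hθdef
  have hθ : 0 < θ := by positivity
  obtain ⟨m, hm⟩ := exists_nat_ge (4 * C / θ)
  obtain ⟨I₂, ε₂, hε₂, hL₂⟩ := exists_entropy_lt_add.{u, v} hs hsum hHs hδ m
  refine ⟨min ε₂ (θ * ε₂ / 4), by positivity, ?_⟩
  intro ι _ ω U h hE hE' hU hδS
  by_contra! hlt
  set ε := min ε₂ (θ * ε₂ / 4) with hε
  have hε0 : 0 < ε := by positivity
  obtain ⟨K', e', s', hs', hs1', hsum', he', hent'⟩ := (isState_finalTarget U h hρ).exists_eigenbasis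
  have hS' : entropy (finalTarget β ω ρ U) ≠ ⊤ :=
    ne_top_of_le_ne_top hS (le_self_add.trans hδS)
  have hX := (tsum_finalOverlap_le_excess U h hρ hs hsum he hs' hsum' he' hS hS' hE hE').trans
    (ENNReal.ofReal_le_ofReal hlt.le)
  rw [hent, hent'] at hδS
  -- If every row of I₁ is within θ, the two target states are compared directly, with a one-level
  -- ancilla. Otherwise one bad row forces the Gibbs state to concentrate, and the comparison uses
  -- the machine itself as ancilla.
  by_cases hcase : ∀ i ∈ I₁, ∑' j, overlap (e i) (e' j) *
      ENNReal.ofReal ((√(s i) - √(s' j)) ^ 2) ≤ ENNReal.ofReal θ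
  · refine (hL₁ K' PUnit s' (fun _ => 1) (fun a b => overlap (e a.1) (e' b.1)) Finset.univ
      ?_ ?_ hs' hsum' (by simp) (by simp) (by simp) (by simp [hε₁.le]) ?_).not_ge hδS
    · intro a
      rw [ENNReal.tsum_prod']
      simp [tsum_overlap', e.orthonormal.1]
    · intro b
      rw [ENNReal.tsum_prod']
      simp [tsum_overlap, e'.orthonormal.1]
    · rw [Finset.sum_product]
      simp_rw [ENNReal.tsum_prod']
      simp only [mul_one, Finset.univ_unique, Finset.sum_singleton, tsum_fintype]
      refine (Finset.sum_le_sum hcase).trans ?_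
      rw [Finset.sum_const, nsmul_eq_mul, ← ENNReal.ofReal_natCast,
        ← ENNReal.ofReal_mul (by positivity)]
      refine ENNReal.ofReal_le_ofReal ?_
      have : θ * (I₁.card + 1) = ε₁ := by rw [hθdef]; field_simp
      nlinarith
  · push Not at hcase
    obtain ⟨i, -, hi⟩ := hcase
    obtain ⟨F, hFm, hF⟩ := exists_concentration U hs hs1 hs' hs1'
      (fun n => (gibbsWeight_pos h n).le) (tsum_ofReal_gibbsWeight h) hU hθ hε0.le hm i hi.le hX
    refine (hL₂ K' ι s' (gibbsWeight β ω) (finalOverlap U e e') F (tsum_finalOverlap_row U)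
      (tsum_finalOverlap_col U) hs' hsum' (fun n => (gibbsWeight_pos h n).le)
      (tsum_ofReal_gibbsWeight h) hFm ?_ ?_).not_ge hδS
    · have h1 : 4 * ε / θ ≤ ε₂ := by
        rw [div_le_iff₀ hθ]
        have := min_le_right ε₂ (θ * ε₂ / 4)
        rw [← hε] at this
        linarith
      linarith
    · exact (sum_le_of_tsum_le hX _).trans (ENNReal.ofReal_le_ofReal (min_le_left _ _))

theorem tendsto_nhds_top_of_excess {ρ : Hilb κ →L[ℂ] Hilb κ} (hρ : IsState ρ)
    (hS : entropy ρ ≠ ⊤) {β δ : ℝ} (hδ : 0 < δ) {ι : ℕ → Type v} [∀ k, Nonempty (ι k)]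
    {ω : ∀ k, ι k → ℝ} {U : ∀ k, unitary (Hilb (κ × ι k) →L[ℂ] Hilb (κ × ι k))}
    (h : ∀ k, Summable fun n => Real.exp (-β * ω k n))
    (hE : ∀ k, HasFiniteEnergy (ω k) (gibbsState β (ω k)))
    (hE' : ∀ k, HasFiniteEnergy (ω k) (finalMachine β (ω k) ρ (U k)))
    (hδS : ∀ᶠ k in atTop,
      entropy (finalTarget β (ω k) ρ (U k)) + ENNReal.ofReal δ ≤ entropy ρ)
    (hlim : Tendsto (fun k => β * energyChange β (ω k) ρ (U k) - entropyDecrease β (ω k) ρ (U k))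
      atTop (𝓝 0))
    {dim : ℕ → ℕ∞} (hdim : ∀ k (d : ℕ), dim k < d → DisplacementLE (U k) (4 * d)) :
    Tendsto dim atTop (𝓝 ⊤) := by
  rw [ENat.tendsto_nhds_top_iff_natCast_lt]
  intro d
  -- A dimension at most d is less than d + 1, hence this C; such k would keep the excess above ε.
  obtain ⟨ε, hε, hbound⟩ := exists_excess_lower_bound.{u, v} hρ hS hδ
    (C := 4 * ((d + 1 : ℕ) : ℝ)) (β := β)
  filter_upwards [hδS, hlim.eventually_lt_const hε] with k hk1 hk2
  by_contra! hk
  exact hk2.not_ge (hbound (ι k) (ω k) (U k) (h k) (hE k) (hE' k)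
    (hdim k (d + 1) (hk.trans_lt (by exact_mod_cast Nat.lt_succ_self d))) hk1)

end Divergence

/-! ### Moving finitely many levels between machines -/

section Transfer

variable {κ : Type u} {ι ι' ι'' J : Type*} [Fintype J]

/-- The partial isometry that maps `x ⊗ |g j⟩` to `x ⊗ |g' j⟩`. -/
noncomputable def levelTransfer (κ : Type u) (g : J → ι) (g' : J → ι') :
    Hilb (κ × ι) →L[ℂ] Hilb (κ × ι') :=
  ∑ j, tensorRight (ket (g' j)) ∘L ContinuousLinearMap.adjoint (tensorRight (κ := κ) (ket (g j)))

theorem levelTransfer_apply (g : J → ι) (g' : J → ι') (z : Hilb (κ × ι)) :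
    levelTransfer κ g g' z =
      ∑ j, tmul (ContinuousLinearMap.adjoint (tensorRight (ket (g j))) z) (ket (g' j)) := by
  rw [levelTransfer, sum_apply]
  rfl

theorem adjoint_tensorRight_tmul_ket (n m : ι) [Decidable (n = m)] (x : Hilb κ) :
    ContinuousLinearMap.adjoint (tensorRight (ket n)) (tmul x (ket m)) = if n = m then x else 0 := by
  rw [adjoint_tensorRight_tmul, inner_ket_ket]
  split_ifs <;> simp

theorem zero_tmul (v : Hilb ι) : tmul (0 : Hilb κ) v = 0 := map_zero (tensorRight v)

theorem levelTransfer_tmul {g : J → ι} (hg : Function.Injective g) (g' : J → ι') (x : Hilb κ)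
    (j : J) : levelTransfer κ g g' (tmul x (ket (g j))) = tmul x (ket (g' j)) := by
  classical
  rw [levelTransfer_apply, Finset.sum_eq_single j]
  · rw [adjoint_tensorRight_tmul_ket, if_pos rfl]
  · intro k _ hk
    rw [adjoint_tensorRight_tmul_ket, if_neg fun h => hk (hg h), zero_tmul]
  · simp

theorem levelTransfer_tmul_of_notMem {g : J → ι} (g' : J → ι') (x : Hilb κ) {n : ι}
    (hn : n ∉ Set.range g) : levelTransfer κ g g' (tmul x (ket n)) = 0 := by
  classical
  rw [levelTransfer_apply]
  refine Finset.sum_eq_zero fun j _ => ?_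
  rw [adjoint_tensorRight_tmul_ket, if_neg fun h => hn ⟨j, h⟩, zero_tmul]

theorem levelTransfer_levelTransfer (g : J → ι) {g' : J → ι'} (hg' : Function.Injective g')
    (g'' : J → ι'') (z : Hilb (κ × ι)) :
    levelTransfer κ g' g'' (levelTransfer κ g g' z) = levelTransfer κ g g'' z := by
  rw [levelTransfer_apply g g', levelTransfer_apply g g'', map_sum]
  simp_rw [levelTransfer_tmul hg']

theorem adjoint_levelTransfer (g : J → ι) (g' : J → ι') :
    ContinuousLinearMap.adjoint (levelTransfer κ g g') = levelTransfer κ g' g := by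
  simp only [levelTransfer, map_sum, ContinuousLinearMap.adjoint_comp,
    ContinuousLinearMap.adjoint_adjoint]

theorem adjoint_tensorRight_levelTransfer (g : J → ι) {g' : J → ι'} (hg' : Function.Injective g')
    (j : J) (z : Hilb (κ × ι)) :
    ContinuousLinearMap.adjoint (tensorRight (ket (g' j))) (levelTransfer κ g g' z) =
      ContinuousLinearMap.adjoint (tensorRight (ket (g j))) z := by
  classical
  rw [levelTransfer_apply, map_sum, Finset.sum_eq_single j]
  · rw [adjoint_tensorRight_tmul_ket, if_pos rfl]
  · intro k _ hk
    rw [adjoint_tensorRight_tmul_ket, if_neg fun h => hk (hg' h).symm]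
  · simp

theorem levelTransfer_mem_targetTensor (g : J → ι) (z : Hilb (κ × ι)) :
    levelTransfer κ g g z ∈ targetTensor κ (levelSpan (Set.range g)) := by
  rw [levelTransfer_apply]
  refine Submodule.sum_mem _ fun j _ => ?_
  exact Submodule.le_topologicalClosure _
    (Submodule.subset_span ⟨_, _, Submodule.subset_span ⟨_, ⟨j, rfl⟩, rfl⟩, rfl⟩)

theorem levelTransfer_of_mem_targetTensor {g : J → ι} (hg : Function.Injective g)
    {z : Hilb (κ × ι)} (hz : z ∈ targetTensor κ (levelSpan (Set.range g))) :
    levelTransfer κ g g z = z := by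
  have hle : targetTensor κ (levelSpan (Set.range g)) ≤
      LinearMap.ker (levelTransfer κ g g - ContinuousLinearMap.id ℂ _).toLinearMap := by
    refine Submodule.topologicalClosure_minimal _ ?_ (ContinuousLinearMap.isClosed_ker _)
    rw [Submodule.span_le]
    rintro _ ⟨x, v, hv, rfl⟩
    have hle2 : levelSpan (Set.range g) ≤ LinearMap.ker
        ((levelTransfer κ g g - ContinuousLinearMap.id ℂ _) ∘L tensorLeft x).toLinearMap := by
      rw [levelSpan, Submodule.span_le]
      rintro _ ⟨_, ⟨j, rfl⟩, rfl⟩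
      simp [tensorLeft_apply, levelTransfer_tmul hg]
    simpa [tensorLeft_apply] using hle2 hv
  have := hle hz
  simpa [sub_eq_zero] using this

theorem inner_levelTransfer_self (g : J → ι) (x y : Hilb (κ × ι)) :
    ⟪x, levelTransfer κ g g y⟫_ℂ = ⟪levelTransfer κ g g x, y⟫_ℂ := by
  rw [← ContinuousLinearMap.adjoint_inner_left, adjoint_levelTransfer]

theorem mem_targetTensor_orthogonal_iff {g : J → ι} (hg : Function.Injective g)
    (z : Hilb (κ × ι)) :
    z ∈ (targetTensor κ (levelSpan (Set.range g)))ᗮ ↔ levelTransfer κ g g z = 0 := by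
  rw [Submodule.mem_orthogonal]
  constructor
  · intro h
    rw [← inner_self_eq_zero (𝕜 := ℂ), inner_levelTransfer_self,
      levelTransfer_levelTransfer g hg]
    exact h _ (levelTransfer_mem_targetTensor g z)
  · intro h x hx
    rw [← levelTransfer_of_mem_targetTensor hg hx, ← inner_levelTransfer_self, h, inner_zero_right]

/-- `levelTransfer κ g g` is the projection onto the levels in the range of g. The geometric
condition thus becomes two operator identities: U fixes the complement and commutes with the
projection. -/
theorem actsOnlyOn_targetTensor_iff {g : J → ι} (hg : Function.Injective g)
    (U : unitary (Hilb (κ × ι) →L[ℂ] Hilb (κ × ι))) :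
    ActsOnlyOn U (targetTensor κ (levelSpan (Set.range g))) ↔
      ∀ z, (U : Hilb (κ × ι) →L[ℂ] Hilb (κ × ι)) (z - levelTransfer κ g g z) =
          z - levelTransfer κ g g z ∧
        levelTransfer κ g g ((U : Hilb (κ × ι) →L[ℂ] Hilb (κ × ι)) z) =
          (U : Hilb (κ × ι) →L[ℂ] Hilb (κ × ι)) (levelTransfer κ g g z) := by
  constructor
  · rintro ⟨h1, h2⟩ z
    have h3 : (U : Hilb (κ × ι) →L[ℂ] Hilb (κ × ι)) (z - levelTransfer κ g g z) =
        z - levelTransfer κ g g z := by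
      refine h2 _ ((mem_targetTensor_orthogonal_iff hg _).2 ?_)
      rw [map_sub, levelTransfer_levelTransfer g hg, sub_self]
    refine ⟨h3, ?_⟩
    have h4 := levelTransfer_of_mem_targetTensor hg (h1 _ (levelTransfer_mem_targetTensor g z))
    have h5 := congrArg (levelTransfer κ g g) h3
    rw [map_sub, map_sub, map_sub, h4, levelTransfer_levelTransfer g hg, sub_self,
      sub_eq_zero] at h5
    exact h5
  · intro h
    constructor
    · intro x hx
      rw [← levelTransfer_of_mem_targetTensor hg hx, ← (h x).2]
      exact levelTransfer_mem_targetTensor g _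
    · intro x hx
      have h1 := (h x).1
      rwa [(mem_targetTensor_orthogonal_iff hg x).1 hx, sub_zero] at h1

end Transfer

/-! ### Transplanting an operator to another machine -/

section Replacement

variable {κ : Type u} {ι ι' J : Type*} [Fintype J]

/-- The operator `V`, moved from the levels `g` to the levels `g'`, and extended by the identity. -/
noncomputable def moveOp (g : J → ι) (g' : J → ι') (V : Hilb (κ × ι) →L[ℂ] Hilb (κ × ι)) :
    Hilb (κ × ι') →L[ℂ] Hilb (κ × ι') :=
  levelTransfer κ g g' ∘L V ∘L levelTransfer κ g' g +
    (ContinuousLinearMap.id ℂ _ - levelTransfer κ g' g')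

variable {g : J → ι} {g' : J → ι'} (hg : Function.Injective g) (hg' : Function.Injective g')

theorem moveOp_apply (V : Hilb (κ × ι) →L[ℂ] Hilb (κ × ι)) (z : Hilb (κ × ι')) :
    moveOp g g' V z =
      levelTransfer κ g g' (V (levelTransfer κ g' g z)) + (z - levelTransfer κ g' g' z) := rfl

-- Since V' commutes with the projection, it does not leave the transferred levels, and the cross
-- terms with the identity part vanish. Used with U and U† in either order, it gives unitarity.
include hg hg' in
theorem moveOp_moveOp {V V' : Hilb (κ × ι) →L[ℂ] Hilb (κ × ι)} (hVV' : ∀ z, V (V' z) = z)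
    (hV' : ∀ z, levelTransfer κ g g (V' z) = V' (levelTransfer κ g g z)) (z : Hilb (κ × ι')) :
    moveOp g g' V (moveOp g g' V' z) = z := by
  simp only [moveOp_apply, map_add, map_sub, levelTransfer_levelTransfer _ hg', levelTransfer_levelTransfer _ hg,
    hV', hVV', sub_self, add_zero]
  abel

theorem adjoint_moveOp (V : Hilb (κ × ι) →L[ℂ] Hilb (κ × ι)) :
    ContinuousLinearMap.adjoint (moveOp g g' V) =
      moveOp g g' (ContinuousLinearMap.adjoint V) := by
  rw [moveOp, moveOp]
  simp only [map_add, map_sub, ContinuousLinearMap.adjoint_comp, adjoint_levelTransfer,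
    ContinuousLinearMap.comp_assoc]
  congr 2
  exact ContinuousLinearMap.isSelfAdjoint_iff'.1 (IsSelfAdjoint.one _)

end Replacement

/-! ### Reduced dynamics in terms of the blocks of U -/

section Unitary

variable {κ : Type u} {ι : Type v} {J : Type*} [Fintype J] {g : J → ι}
  {U : unitary (Hilb (κ × ι) →L[ℂ] Hilb (κ × ι))}

theorem unitary_apply_adjoint {H : Type*} [NormedAddCommGroup H] [InnerProductSpace ℂ H]
    [CompleteSpace H] (U : unitary (H →L[ℂ] H)) (x : H) :
    (U : H →L[ℂ] H) (ContinuousLinearMap.adjoint (U : H →L[ℂ] H) x) = x := by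
  rw [← ContinuousLinearMap.star_eq_adjoint, ← mul_apply_eq_comp, Unitary.mul_star_self_of_mem U.2]
  rfl

theorem adjoint_unitary_apply {H : Type*} [NormedAddCommGroup H] [InnerProductSpace ℂ H]
    [CompleteSpace H] (U : unitary (H →L[ℂ] H)) (x : H) :
    ContinuousLinearMap.adjoint (U : H →L[ℂ] H) ((U : H →L[ℂ] H) x) = x := by
  rw [← ContinuousLinearMap.star_eq_adjoint, ← mul_apply_eq_comp, Unitary.star_mul_self_of_mem U.2]
  rfl

theorem exists_moved_unitary {ι' : Type*} {g' : J → ι'} (hg : Function.Injective g)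
    (hg' : Function.Injective g')
    (hU : ActsOnlyOn U (targetTensor κ (levelSpan (Set.range g)))) :
    ∃ U' : unitary (Hilb (κ × ι') →L[ℂ] Hilb (κ × ι')),
      (U' : Hilb (κ × ι') →L[ℂ] Hilb (κ × ι')) = moveOp g g' U ∧
      ActsOnlyOn U' (targetTensor κ (levelSpan (Set.range g'))) := by
  rw [actsOnlyOn_targetTensor_iff hg] at hU
  have hadj : ∀ z, levelTransfer κ g g
      (ContinuousLinearMap.adjoint (U : Hilb (κ × ι) →L[ℂ] Hilb (κ × ι)) z) =
      ContinuousLinearMap.adjoint (U : Hilb (κ × ι) →L[ℂ] Hilb (κ × ι))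
        (levelTransfer κ g g z) := by
    intro z
    have h1 := (hU (ContinuousLinearMap.adjoint (U : Hilb (κ × ι) →L[ℂ] Hilb (κ × ι)) z)).2
    rw [unitary_apply_adjoint] at h1
    rw [h1, adjoint_unitary_apply]
  have hmem : moveOp g g' (U : Hilb (κ × ι) →L[ℂ] Hilb (κ × ι)) ∈
      unitary (Hilb (κ × ι') →L[ℂ] Hilb (κ × ι')) := by
    rw [Unitary.mem_iff, ContinuousLinearMap.star_eq_adjoint, adjoint_moveOp]
    constructor
    · ext1 z
      exact moveOp_moveOp hg hg' (adjoint_unitary_apply U) (fun z => (hU z).2) z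
    · ext1 z
      exact moveOp_moveOp hg hg' (unitary_apply_adjoint U) hadj z
  refine ⟨⟨_, hmem⟩, rfl, ?_⟩
  rw [actsOnlyOn_targetTensor_iff hg']
  intro z
  constructor
  · simp only [moveOp_apply, map_sub, levelTransfer_levelTransfer _ hg', sub_self]
    abel
  · simp only [moveOp_apply, map_add, map_sub, levelTransfer_levelTransfer _ hg', sub_self,
      add_zero]

/-- The block `⟨n| V |m⟩`, an operator on the target. -/
noncomputable def block (V : Hilb (κ × ι) →L[ℂ] Hilb (κ × ι)) (n m : ι) : Hilb κ →L[ℂ] Hilb κ :=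
  ContinuousLinearMap.adjoint (tensorRight (ket n)) ∘L V ∘L tensorRight (ket m)

theorem block_moveOp {ι' : Type*} {g' : J → ι'}
    (hg' : Function.Injective g') (V : Hilb (κ × ι) →L[ℂ] Hilb (κ × ι)) (i j : J) :
    block (moveOp g g' V) (g' i) (g' j) = block V (g i) (g j) := by
  ext1 x
  simp only [block, ContinuousLinearMap.comp_apply, tensorRight_apply, moveOp_apply,
    levelTransfer_tmul hg', sub_self, add_zero, adjoint_tensorRight_levelTransfer g hg']

theorem inner_ket_block (V : Hilb (κ × ι) →L[ℂ] Hilb (κ × ι)) (n m : ι) (a b : κ) :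
    ⟪ket a, block V n m (ket b)⟫_ℂ = ⟪ket (a, n), V (ket (b, m))⟫_ℂ := by
  rw [block, ContinuousLinearMap.comp_apply, inner_adjoint_tensorRight, tmul_ket_ket,
    ContinuousLinearMap.comp_apply, tensorRight_apply, tmul_ket_ket]

variable {β : ℝ} {ω : ι → ℝ} {ρ : Hilb κ →L[ℂ] Hilb κ} [Nonempty ι]
  (h : Summable fun n => Real.exp (-β * ω n)) (hg : Function.Injective g)
  (hU : ActsOnlyOn U (targetTensor κ (levelSpan (Set.range g))))
include h hg hU

/-- U† keeps x ⊗ |g i⟩ within the used levels, so only finitely many Gibbs weights enter. -/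
theorem block_finalState_of_mem (i : J) :
    block (finalState β ω ρ U) (g i) (g i) = ∑ j, (gibbsWeight β ω (g j) : ℂ) •
      (block (U : Hilb (κ × ι) →L[ℂ] Hilb (κ × ι)) (g i) (g j) ∘L ρ ∘L
        ContinuousLinearMap.adjoint
          (block (U : Hilb (κ × ι) →L[ℂ] Hilb (κ × ι)) (g i) (g j))) := by
  rw [actsOnlyOn_targetTensor_iff hg] at hU
  ext1 x
  have h1 : ContinuousLinearMap.adjoint (U : Hilb (κ × ι) →L[ℂ] Hilb (κ × ι))
      (tmul x (ket (g i))) = levelTransfer κ g g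
        (ContinuousLinearMap.adjoint (U : Hilb (κ × ι) →L[ℂ] Hilb (κ × ι))
          (tmul x (ket (g i)))) := by
    have h2 := (hU (ContinuousLinearMap.adjoint (U : Hilb (κ × ι) →L[ℂ] Hilb (κ × ι))
      (tmul x (ket (g i))))).2
    rw [unitary_apply_adjoint, levelTransfer_tmul hg] at h2
    have h3 := congrArg (ContinuousLinearMap.adjoint (U : Hilb (κ × ι) →L[ℂ] Hilb (κ × ι))) h2
    rwa [adjoint_unitary_apply] at h3
  simp only [block, finalState, ContinuousLinearMap.comp_apply, tensorRight_apply, sum_apply,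
    smul_apply, ContinuousLinearMap.adjoint_comp, ContinuousLinearMap.adjoint_adjoint]
  conv_lhs => rw [h1, levelTransfer_apply, map_sum, map_sum, map_sum]
  refine Finset.sum_congr rfl fun j _ => ?_
  rw [initialState_tmul h, map_smul, map_smul]

theorem block_finalState_of_notMem {n : ι} (hn : n ∉ Set.range g) :
    block (finalState β ω ρ U) n n = (gibbsWeight β ω n : ℂ) • ρ := by
  classical
  rw [actsOnlyOn_targetTensor_iff hg] at hU
  have h1 : ∀ x : Hilb κ, (U : Hilb (κ × ι) →L[ℂ] Hilb (κ × ι)) (tmul x (ket n)) =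
      tmul x (ket n) := by
    intro x
    have h2 := (hU (tmul x (ket n))).1
    rwa [levelTransfer_tmul_of_notMem g x hn, sub_zero] at h2
  ext1 x
  have h3 : ContinuousLinearMap.adjoint (U : Hilb (κ × ι) →L[ℂ] Hilb (κ × ι))
      (tmul x (ket n)) = tmul x (ket n) := by
    nth_rewrite 1 [← h1 x]
    exact adjoint_unitary_apply U _
  simp only [block, finalState, ContinuousLinearMap.comp_apply, tensorRight_apply, smul_apply, h3,
    initialState_tmul h, map_smul, h1, adjoint_tensorRight_tmul_ket, if_true]

/-- The partial trace is the sum of diagonal blocks; subtracting ϱ = ∑ pₙϱ leaves only the used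
levels. -/
theorem finalTarget_eq :
    finalTarget β ω ρ U = ρ + ∑ j, (block (finalState β ω ρ U) (g j) (g j) -
      (gibbsWeight β ω (g j) : ℂ) • ρ) := by
  have h1 : HasSum (fun n => (gibbsWeight β ω n : ℂ) • ρ) ρ := by
    have := ((hasSum_gibbsWeight h).mapL Complex.ofRealCLM).smul_const ρ
    simpa using this
  have h2 : HasSum (fun n => block (finalState β ω ρ U) n n - (gibbsWeight β ω n : ℂ) • ρ)
      (∑ j, (block (finalState β ω ρ U) (g j) (g j) - (gibbsWeight β ω (g j) : ℂ) • ρ)) := by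
    rw [← hg.hasSum_iff]
    · exact hasSum_fintype _
    · intro n hn
      rw [block_finalState_of_notMem h hg hU hn, sub_self]
  have h3 := h1.add h2
  simp only [add_sub_cancel] at h3
  exact h3.tsum_eq

omit hg hU in
theorem finalPopulation_eq (hρ : IsState ρ) (n : ι) :
    finalPopulation U β ω ρ n = (posTrace (block (finalState β ω ρ U) n n)).toReal := by
  have hpos := isPositive_finalState U h hρ.1
  have htr : posTrace (finalState β ω ρ U) ≠ ⊤ :=
    posTrace_finalState U h hρ ▸ ENNReal.one_ne_top
  have h1 := ofReal_inner_traceTarget hpos htr (ket n)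
  rw [← ENNReal.toReal_ofReal (finalPopulation_nonneg U h hρ n), finalPopulation, finalMachine, h1]
  simp_rw [posTrace, inner_ket_block, tmul_ket_ket]

/-- Populations of unused levels are unchanged, so the sum is finite without any finite-energy
hypothesis. -/
theorem energyChange_eq_sum (hρ : IsState ρ) :
    energyChange β ω ρ U = ∑ j, ω (g j) *
      ((posTrace (block (finalState β ω ρ U) (g j) (g j))).toReal - gibbsWeight β ω (g j)) := by
  rw [energyChange_eq_tsum U h]
  refine HasSum.tsum_eq ?_
  rw [← hg.hasSum_iff]
  · simp_rw [← finalPopulation_eq h hρ]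
    exact hasSum_fintype _
  · intro n hn
    have h1 : posTrace ((gibbsWeight β ω n : ℂ) • ρ) = ENNReal.ofReal (gibbsWeight β ω n) := by
      rw [posTrace]
      simp_rw [smul_apply, inner_smul_right, Complex.re_ofReal_mul,
        ENNReal.ofReal_mul (gibbsWeight_pos h n).le, ENNReal.tsum_mul_left,
        (isState_iff hρ.1).1 hρ, mul_one]
    rw [finalPopulation_eq h hρ, block_finalState_of_notMem h hg hU hn, h1,
      ENNReal.toReal_ofReal (gibbsWeight_pos h n).le, sub_self, mul_zero]

end Unitary

/-! ### The finite replacement machine and the finite-size correction -/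

section FiniteMachine

/-- One extra level of energy −(log r)/β carries the Boltzmann weight r of all levels outside F. If
F is everything then r = 0 and no level is added. -/
theorem exists_finite_spectrum {ι : Type v} [Nonempty ι] {β : ℝ} {ω : ι → ℝ} (hβ : 0 < β)
    (h : Summable fun n => Real.exp (-β * ω n)) (F : Finset ι) :
    ∃ (N : ℕ) (ω' : Fin N → ℝ) (e : F → Fin N), N ≤ F.card + 1 ∧ Function.Injective e ∧
      (∀ n, ω' (e n) = ω n) ∧ partitionFn β ω' = partitionFn β ω := by
  classical
  have hsum : ∑ i : Fin F.card, Real.exp (-β * ω (F.equivFin.symm i)) =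
      ∑ n ∈ F, Real.exp (-β * ω n) := by
    rw [← Finset.sum_coe_sort F fun n => Real.exp (-β * ω n)]
    exact Equiv.sum_comp F.equivFin.symm fun n : F => Real.exp (-β * ω n)
  by_cases hF : ∀ n, n ∈ F
  · refine ⟨F.card, fun i => ω (F.equivFin.symm i), F.equivFin, by omega,
      F.equivFin.injective, fun n => by simp, ?_⟩
    rw [partitionFn, partitionFn, tsum_fintype, hsum, tsum_eq_sum (s := F)]
    exact fun n hn => absurd (hF n) hn
  · push Not at hF
    obtain ⟨n₀, hn₀⟩ := hF
    set r := partitionFn β ω - ∑ n ∈ F, Real.exp (-β * ω n) with hr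
    have hr0 : 0 < r := by
      have h1 := h.sum_le_tsum (insert n₀ F) fun n _ => (Real.exp_pos _).le
      rw [Finset.sum_insert hn₀] at h1
      have h2 := Real.exp_pos (-β * ω n₀)
      rw [hr, partitionFn]
      linarith
    refine ⟨F.card + 1, Fin.snoc (fun i => ω (F.equivFin.symm i)) (-Real.log r / β),
      fun n => (F.equivFin n).castSucc, le_rfl,
      (Fin.castSucc_injective _).comp F.equivFin.injective, fun n => by simp, ?_⟩
    rw [partitionFn, tsum_fintype, Fin.sum_univ_castSucc]
    simp only [Fin.snoc_castSucc, Fin.snoc_last]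
    rw [hsum, show -β * (-Real.log r / β) = Real.log r by field_simp, Real.exp_log hr0, hr]
    ring

/-- A machine of which only finitely many levels are used can be replaced by a finite one. -/
theorem exists_finite_machine {κ : Type u} {ι : Type v} [Nonempty ι] {β : ℝ} {ω : ι → ℝ}
    {ρ : Hilb κ →L[ℂ] Hilb κ} (U : unitary (Hilb (κ × ι) →L[ℂ] Hilb (κ × ι))) (F : Finset ι)
    (hβ : 0 < β) (h : Summable fun n => Real.exp (-β * ω n)) (hρ : IsState ρ)
    (hU : ActsOnlyOn U (targetTensor κ (levelSpan (F : Set ι)))) :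
    ∃ (N : ℕ) (ω' : Fin N → ℝ) (U' : unitary (Hilb (κ × Fin N) →L[ℂ] Hilb (κ × Fin N)))
      (e : F → Fin N),
      N ≤ F.card + 1 ∧ Function.Injective e ∧
      (∀ n, ω' (e n) = ω n) ∧ partitionFn β ω' = partitionFn β ω ∧
      ActsOnlyOn U' (targetTensor κ (levelSpan (Set.range e))) ∧
      (∀ (a b : κ) (n m : F),
        ⟪ket (a, e n), (U' : Hilb (κ × Fin N) →L[ℂ] Hilb (κ × Fin N)) (ket (b, e m))⟫_ℂ =
          ⟪ket (a, (n : ι)), (U : Hilb (κ × ι) →L[ℂ] Hilb (κ × ι)) (ket (b, (m : ι)))⟫_ℂ) ∧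
      finalTarget β ω' ρ U' = finalTarget β ω ρ U ∧
      entropyDecrease β ω' ρ U' = entropyDecrease β ω ρ U ∧
      energyChange β ω' ρ U' = energyChange β ω ρ U := by
  obtain ⟨N, ω', e, hN, he, hω, hZ⟩ := exists_finite_spectrum hβ h F
  have hg : Function.Injective (Subtype.val : F → ι) := Subtype.val_injective
  have hrange : Set.range (Subtype.val : F → ι) = (F : Set ι) := by simp
  rw [← hrange] at hU
  obtain ⟨U', hU', hact⟩ := exists_moved_unitary hg he hU
  have h' : Summable fun n => Real.exp (-β * ω' n) := (hasSum_fintype _).summable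
  have hne : Nonempty (Fin N) := by
    by_contra hemp
    rw [not_nonempty_iff] at hemp
    have h1 := partitionFn_pos h
    rw [← hZ, partitionFn, tsum_empty] at h1
    exact lt_irrefl _ h1
  have hp : ∀ n, gibbsWeight β ω' (e n) = gibbsWeight β ω n := fun n => by
    rw [gibbsWeight, gibbsWeight, hω, hZ]
  have hb : ∀ n m : F, block (U' : Hilb (κ × Fin N) →L[ℂ] Hilb (κ × Fin N)) (e n) (e m) =
      block (U : Hilb (κ × ι) →L[ℂ] Hilb (κ × ι)) n m := fun n m => by
    rw [hU', block_moveOp he]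
  have hbs : ∀ n : F, block (finalState β ω' ρ U') (e n) (e n) =
      block (finalState β ω ρ U) n n := fun n => by
    rw [block_finalState_of_mem h' he hact, block_finalState_of_mem h hg hU]
    simp_rw [hb, hp]
  have hT : finalTarget β ω' ρ U' = finalTarget β ω ρ U := by
    rw [finalTarget_eq h' he hact, finalTarget_eq h hg hU]
    simp_rw [hbs, hp]
  refine ⟨N, ω', U', e, hN, he, hω, hZ, hact, ?_, hT, ?_, ?_⟩
  · intro a b n m
    rw [← inner_ket_block, ← inner_ket_block, hb]
  · rw [entropyDecrease, entropyDecrease, hT]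
  · rw [energyChange_eq_sum h' he hact hρ, energyChange_eq_sum h hg hU hρ]
    simp_rw [hbs, hp, hω]

/-- The pairs with entropy gap at least δ form a compact set on which the Hellinger distance cannot
vanish, since p = q has gap 0. If there are no such pairs, any constant serves. -/
theorem exists_hellinger_lower_bound (N : ℕ) {δ : ℝ} (hδ : 0 < δ) :
    ∃ c : ℝ, 0 < c ∧ ∀ p q : Fin N → ℝ, p ∈ stdSimplex ℝ (Fin N) → q ∈ stdSimplex ℝ (Fin N) →
      δ ≤ ∑ n, Real.negMulLog (q n) - ∑ n, Real.negMulLog (p n) →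
      c ≤ ∑ n, (√(q n) - √(p n)) ^ 2 := by
  set S : Set ((Fin N → ℝ) × (Fin N → ℝ)) :=
    (stdSimplex ℝ (Fin N) ×ˢ stdSimplex ℝ (Fin N)) ∩
      {z | δ ≤ ∑ n, Real.negMulLog (z.2 n) - ∑ n, Real.negMulLog (z.1 n)} with hS
  have hcont : Continuous fun z : (Fin N → ℝ) × (Fin N → ℝ) =>
      ∑ n, Real.negMulLog (z.2 n) - ∑ n, Real.negMulLog (z.1 n) := by
    refine Continuous.sub ?_ ?_ <;>
    exact continuous_finsetSum _ fun n _ => Real.continuous_negMulLog.comp (by fun_prop)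
  have hcont2 : Continuous fun z : (Fin N → ℝ) × (Fin N → ℝ) =>
      ∑ n, (√(z.2 n) - √(z.1 n)) ^ 2 := by fun_prop
  have hcomp : IsCompact S :=
    ((isCompact_stdSimplex ℝ _).prod (isCompact_stdSimplex ℝ _)).inter_right
      (isClosed_le continuous_const hcont)
  rcases S.eq_empty_or_nonempty with hemp | hne
  · refine ⟨1, one_pos, fun p q hp hq hpq => ?_⟩
    have : (p, q) ∈ S := ⟨⟨hp, hq⟩, hpq⟩
    rw [hemp] at this
    exact this.elim
  · obtain ⟨z, hz, hmin⟩ := hcomp.exists_isMinOn hne hcont2.continuousOn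
    refine ⟨∑ n, (√(z.2 n) - √(z.1 n)) ^ 2, ?_, fun p q hp hq hpq =>
      hmin (show (p, q) ∈ S from ⟨⟨hp, hq⟩, hpq⟩)⟩
    refine lt_of_le_of_ne (Finset.sum_nonneg fun _ _ => sq_nonneg _) fun h0 => ?_
    have h1 := (Finset.sum_eq_zero_iff_of_nonneg fun _ _ => sq_nonneg _).1 h0.symm
    have h2 : z.2 = z.1 := by
      ext n
      have h3 := pow_eq_zero_iff two_ne_zero |>.1 (h1 n (Finset.mem_univ n))
      exact (Real.sqrt_inj (hz.1.2.1 n) (hz.1.1.1 n)).1 (sub_eq_zero.1 h3)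
    have h3 : δ ≤ ∑ n, Real.negMulLog (z.2 n) - ∑ n, Real.negMulLog (z.1 n) := hz.2
    rw [h2, sub_self] at h3
    exact hδ.not_ge h3

/-- The Landauer bound for a finite machine, with the Hellinger distance of the populations. -/
theorem landauer_finite {κ : Type u} {N : ℕ} [Nonempty (Fin N)] {β : ℝ} {ω : Fin N → ℝ}
    {ρ : Hilb κ →L[ℂ] Hilb κ} (U : unitary (Hilb (κ × Fin N) →L[ℂ] Hilb (κ × Fin N)))
    (hρ : IsState ρ) (hS : entropy ρ ≠ ⊤) (hS' : entropy (finalTarget β ω ρ U) ≠ ⊤) :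
    entropyDecrease β ω ρ U ≤ ∑ n, Real.negMulLog (finalPopulation U β ω ρ n) -
        ∑ n, Real.negMulLog (gibbsWeight β ω n) ∧
      ∑ n, Real.negMulLog (finalPopulation U β ω ρ n) - ∑ n, Real.negMulLog (gibbsWeight β ω n) +
        ∑ n, (√(finalPopulation U β ω ρ n) - √(gibbsWeight β ω n)) ^ 2 ≤
      β * energyChange β ω ρ U := by
  have h : Summable fun n => Real.exp (-β * ω n) := (hasSum_fintype _).summable
  obtain ⟨K, e, s, hs, -, hs1, he, -⟩ := hρ.exists_eigenbasis
  obtain ⟨K', e', s', hs', -, hs1', he', -⟩ := (isState_finalTarget U h hρ).exists_eigenbasis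
  set q := finalPopulation U β ω ρ with hq
  set p := gibbsWeight β ω with hp
  have hq0 : ∀ n, 0 ≤ q n := finalPopulation_nonneg U h hρ
  have hq1 := tsum_finalPopulation U h hρ
  have hqle := le_one_of_tsum_ofReal hq1
  have hp0 : ∀ n, 0 < p n := gibbsWeight_pos h
  have hqs : ∑ n, q n = 1 := (hasSum_fintype q).unique (hasSum_of_tsum_ofReal hq0 hq1)
  have hps : ∑ n, p n = 1 := (hasSum_fintype p).unique (hasSum_gibbsWeight h)
  have hηq := fun n => Real.negMulLog_nonneg (hq0 n) (hqle n)
  have hηp := fun n => Real.negMulLog_nonneg (hp0 n).le (gibbsWeight_le_one h n)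
  constructor
  -- The reference weights are the final populations themselves, so the Shannon entropy of the
  -- diagonal replaces the von Neumann entropy of the final machine state.
  · have hb := entropy_balance_finalState U h hρ hs hs1 he hs' hs1' he' hq0 hq1 fun l hl => hl
    have h1 : ∑' n, ENNReal.ofReal (q n) * ENNReal.ofReal (-Real.log (q n)) =
        ENNReal.ofReal (∑ n, Real.negMulLog (q n)) := by
      rw [tsum_fintype, ENNReal.ofReal_sum_of_nonneg fun n _ => hηq n]
      refine Finset.sum_congr rfl fun n _ => ?_
      rw [← ENNReal.ofReal_mul (hq0 n), Real.negMulLog, neg_mul, mul_neg]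
    have h2 : ∑' n, ENNReal.ofReal (Real.negMulLog (p n)) =
        ENNReal.ofReal (∑ n, Real.negMulLog (p n)) := by
      rw [tsum_fintype, ENNReal.ofReal_sum_of_nonneg fun n _ => hηp n]
    have hb2 := le_self_add.trans hb
    rw [h1, h2, ← ENNReal.ofReal_toReal hS, ← ENNReal.ofReal_toReal hS',
      ← ENNReal.ofReal_add ENNReal.toReal_nonneg (Finset.sum_nonneg fun n _ => hηp n),
      ← ENNReal.ofReal_add ENNReal.toReal_nonneg (Finset.sum_nonneg fun n _ => hηq n),
      ENNReal.ofReal_le_ofReal_iff (add_nonneg ENNReal.toReal_nonneg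
        (Finset.sum_nonneg fun n _ => hηq n))] at hb2
    rw [entropyDecrease]
    linarith
  · have h1 : ∑ n, (Real.negMulLog (q n) + (√(q n) - √(p n)) ^ 2 + q n) ≤
        ∑ n, (q n * -Real.log (p n) + p n) :=
      Finset.sum_le_sum fun n _ =>
        negMulLog_add_sq_le (hq0 n) (hp0 n).le fun h0 => absurd h0 (hp0 n).ne'
    rw [Finset.sum_add_distrib, Finset.sum_add_distrib, Finset.sum_add_distrib, hqs, hps] at h1
    have h2 : β * energyChange β ω ρ U =
        ∑ n, q n * -Real.log (p n) - ∑ n, Real.negMulLog (p n) := by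
      -- Both distributions are normalised, so log Z drops out of βΔE.
      have h3 : ∑ n, (q n - p n) * Real.log (partitionFn β ω) = 0 := by
        rw [← Finset.sum_mul, Finset.sum_sub_distrib, hqs, hps, sub_self, zero_mul]
      rw [energyChange_eq_tsum U h, tsum_fintype, Finset.mul_sum, ← Finset.sum_sub_distrib,
        ← add_zero (∑ n, β * _), ← h3, ← Finset.sum_add_distrib]
      refine Finset.sum_congr rfl fun n _ => ?_
      rw [Real.negMulLog, neg_mul, ← mul_neg, hp, log_gibbsWeight h]
      ring
    linarith

/-- The finite-size correction to the Landauer bound. -/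
theorem exists_finite_size_correction {δ : ℝ} (hδ : 0 < δ) (m : ℕ) :
    ∃ c : ℝ, 0 < c ∧ ∀ (κ : Type u) (ι : Type v) [Nonempty ι] (β : ℝ) (ω : ι → ℝ)
      (ρ : Hilb κ →L[ℂ] Hilb κ) (U : unitary (Hilb (κ × ι) →L[ℂ] Hilb (κ × ι))) (F : Finset ι),
      0 < β → (Summable fun n => Real.exp (-β * ω n)) → IsState ρ → entropy ρ ≠ ⊤ →
      F.card ≤ m → ActsOnlyOn U (targetTensor κ (levelSpan (F : Set ι))) →
      entropy (finalTarget β ω ρ U) + ENNReal.ofReal δ ≤ entropy ρ →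
      entropyDecrease β ω ρ U + c ≤ β * energyChange β ω ρ U := by
  choose c hc0 hc using fun N => exists_hellinger_lower_bound N hδ
  -- The replacement has N ≤ m + 1 levels, hence `range (m + 2)`; the minimum over N makes the
  -- constant uniform.
  obtain ⟨M, -, hM⟩ := Finset.exists_min_image (Finset.range (m + 2)) c ⟨0, by simp⟩
  refine ⟨c M, hc0 M, ?_⟩
  intro κ ι _ β ω ρ U F hβ h hρ hS hF hU hδS
  obtain ⟨N, ω', U', e, hN, -, -, hZ, -, -, hT, hD, hE⟩ := exists_finite_machine U F hβ h hρ hU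
  have hne : Nonempty (Fin N) := by
    by_contra hemp
    rw [not_nonempty_iff] at hemp
    have h1 := partitionFn_pos h
    rw [← hZ, partitionFn, tsum_empty] at h1
    exact lt_irrefl _ h1
  have hS' : entropy (finalTarget β ω ρ U) ≠ ⊤ := ne_top_of_le_ne_top hS (le_self_add.trans hδS)
  have hdec : δ ≤ entropyDecrease β ω ρ U := by
    rw [← ENNReal.ofReal_toReal hS, ← ENNReal.ofReal_toReal hS',
      ← ENNReal.ofReal_add ENNReal.toReal_nonneg hδ.le,
      ENNReal.ofReal_le_ofReal_iff ENNReal.toReal_nonneg] at hδS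
    rw [entropyDecrease]
    linarith
  have h' : Summable fun n => Real.exp (-β * ω' n) := (hasSum_fintype _).summable
  obtain ⟨h1, h2⟩ := landauer_finite (β := β) (ω := ω') U' hρ hS (hT ▸ hS')
  rw [hD] at h1
  rw [hE] at h2
  have hq0 := finalPopulation_nonneg U' h' hρ
  have h3 := hc N (gibbsWeight β ω') (finalPopulation U' β ω' ρ)
    ⟨fun n => (gibbsWeight_pos h' n).le,
      (hasSum_fintype _).unique (hasSum_gibbsWeight h')⟩
    ⟨hq0, (hasSum_fintype _).unique (hasSum_of_tsum_ofReal hq0 (tsum_finalPopulation U' h' hρ))⟩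
    (hdec.trans h1)
  have h4 := hM N (Finset.mem_range.2 (by omega))
  linarith

end FiniteMachine

end LandauerCooling

open LandauerCooling
theorem mainTheorem5 :
    -- a machine of which only finitely many levels are used can be replaced by a finite one
    (∀ (κ : Type u) (ι : Type v) [Nonempty ι] (β : ℝ) (ω : ι → ℝ) (ρ : Hilb κ →L[ℂ] Hilb κ)
      (U : unitary (Hilb (κ × ι) →L[ℂ] Hilb (κ × ι))) (F : Finset ι),
      0 < β → (Summable fun n => Real.exp (-β * ω n)) → IsState ρ →
      ActsOnlyOn U (targetTensor κ (levelSpan (F : Set ι))) →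
      ∃ (N : ℕ) (ω' : Fin N → ℝ) (U' : unitary (Hilb (κ × Fin N) →L[ℂ] Hilb (κ × Fin N)))
        (e : F → Fin N),
        N ≤ F.card + 1 ∧ Function.Injective e ∧
        (∀ n, ω' (e n) = ω n) ∧ partitionFn β ω' = partitionFn β ω ∧
        ActsOnlyOn U' (targetTensor κ (levelSpan (Set.range e))) ∧
        (∀ (a b : κ) (n m : F),
          ⟪ket (a, e n), (U' : Hilb (κ × Fin N) →L[ℂ] Hilb (κ × Fin N)) (ket (b, e m))⟫_ℂ =
            ⟪ket (a, (n : ι)), (U : Hilb (κ × ι) →L[ℂ] Hilb (κ × ι)) (ket (b, (m : ι)))⟫_ℂ) ∧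
        finalTarget β ω' ρ U' = finalTarget β ω ρ U ∧
        entropyDecrease β ω' ρ U' = entropyDecrease β ω ρ U ∧
        energyChange β ω' ρ U' = energyChange β ω ρ U) ∧
    -- a finite-size correction to the Landauer bound
    (∀ (δ : ℝ) (m : ℕ), 0 < δ → ∃ c : ℝ, 0 < c ∧
      ∀ (κ : Type u) (ι : Type v) [Nonempty ι] (β : ℝ) (ω : ι → ℝ) (ρ : Hilb κ →L[ℂ] Hilb κ)
        (U : unitary (Hilb (κ × ι) →L[ℂ] Hilb (κ × ι))) (F : Finset ι),
        0 < β → (Summable fun n => Real.exp (-β * ω n)) → IsState ρ → entropy ρ ≠ ⊤ →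
        F.card ≤ m → ActsOnlyOn U (targetTensor κ (levelSpan (F : Set ι))) →
        entropy (finalTarget β ω ρ U) + ENNReal.ofReal δ ≤ entropy ρ →
        entropyDecrease β ω ρ U + c ≤ β * energyChange β ω ρ U) ∧
    -- cooling at the Landauer limit needs diverging dimension
    (∀ (κ : Type u) (β : ℝ) (ρ : Hilb κ →L[ℂ] Hilb κ) (ι : ℕ → Type v) [∀ k, Nonempty (ι k)]
      (ω : ∀ k, ι k → ℝ) (U : ∀ k, unitary (Hilb (κ × ι k) →L[ℂ] Hilb (κ × ι k))) (δ : ℝ),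
      0 < β → IsState ρ → entropy ρ ≠ ⊤ →
      (∀ k, Summable fun n => Real.exp (-β * ω k n)) →
      (∀ k, HasFiniteEnergy (ω k) (gibbsState β (ω k))) →
      (∀ k, HasFiniteEnergy (ω k) (finalMachine β (ω k) ρ (U k))) →
      0 < δ →
      (∀ᶠ k in atTop,
        entropy (finalTarget β (ω k) ρ (U k)) + ENNReal.ofReal δ ≤ entropy ρ) →
      Tendsto (fun k => β * energyChange β (ω k) ρ (U k) - entropyDecrease β (ω k) ρ (U k))
        atTop (𝓝 0) →
      Tendsto (fun k => machineDim (U k)) atTop (𝓝 ⊤) ∧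
        Tendsto (fun k => effectiveDim (U k)) atTop (𝓝 ⊤)) := by
  refine ⟨?_, ?_, ?_⟩
  · intro κ ι _ β ω ρ U F hβ h hρ hU
    exact exists_finite_machine U F hβ h hρ hU
  · intro δ m hδ
    exact exists_finite_size_correction hδ m
  · intro κ β ρ ι _ ω U δ hβ hρ hS h hE hE' hδ hδS hlim
    exact ⟨tendsto_nhds_top_of_excess hρ hS hδ h hE hE' hδS hlim fun k d hd =>
        displacementLE_of_machineDim hd,
      tendsto_nhds_top_of_excess hρ hS hδ h hE hE' hδS hlim fun k d hd =>
        displacementLE_of_effectiveDim hd⟩
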